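/- Let $\pi$ be a group and let $A=\mathbb Z[\pi]$ be its integral group ring, with the involution $\overline{\sum n_g g}=\sum n_g g^{-1}$. Let $\Gamma\subset A$ be one of the two form parameters $$\Gamma_{\min}=\{a+\bar a \mid a\in A\},\qquad \widetilde\Gamma=\{n\cdot 1+a+\bar a \mid n\in\mathbb Z,\ a\in A\}.$$ For $r\ge 0$ let $H^r_-(A)$ be the skew-quadratic hyperbolic form with form parameter $\Gamma$: the free left $A$-module with basis $e_1,\dots,e_r,f_1,\dots,f_r$, with the skew-hermitian form $\lambda(x,y)=\sum_i\big(x_{e_i}\overline{y_{f_i}}-x_{f_i}\overline{y_{e_i}}\big)$ and the quadratic refinement $\mu(x)=\big[\sum_i x_{e_i}\overline{x_{f_i}}\big]\in A/\Gamma$. Call an automorphism of a finitely generated free based $A$-module simple if its torsion in the Whitehead group $Wh(\pi)=K_1(A)/\{\pm g\mid g\in\pi\}$ vanishes. Let $SU_r(A,\Gamma)$ be the group of simple automorphisms of $H^r_-(A)$ preserving $\lambda$ and $\mu$, and $SU(A,\Gamma)=\bigcup_r SU_r(A,\Gamma)$, where $\alpha\in SU_r$ is identified with $\alpha\oplus \mathrm{id}\in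 SU_{r+1}$. Let $RU(A,\Gamma)\subset SU(A,\Gamma)$ be the subgroup generated by the elements that map the standard Lagrangian spanned by all $e_i$ onto itself by a simple automorphism and by the flips $e_i\mapsto f_i,\ f_i\mapsto -e_i$ (all other basis vectors being fixed); it is a normal subgroup. Put $$L^s_3(\pi)=SU(A,\Gamma_{\min})/RU(A,\Gamma_{\min}),\qquad L^{s\sim}_3(\pi)=SU(A,\widetilde\Gamma)/RU(A,\widetilde\Gamma).$$ **Lemma 3.5 (Kreck).** For every group $\pi$, the natural homomorphism $L^s_3(\pi)\to L^{s\sim}_3(\pi)$, induced by the inclusion $SU(A,\Gamma_{\min})\subset SU(A,\widetilde\Gamma)$, is surjective. -/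

import Mathlib

noncomputable section

namespace OddL

/-! ### Simple automorphisms -/

section Simple

variable {A : Type*} [Ring A] {ι κ : Type*}

/-- The automorphism group of the free left `A`-module on the basis `ι`. -/
abbrev Aut (A : Type*) [Ring A] (ι : Type*) : Type _ := (ι →₀ A) ≃ₗ[A] (ι →₀ A)

/-- `α` is the elementary automorphism `b_p ↦ b_p + a • b_q` (with `p ≠ q`), fixing all other
basis vectors. -/
def IsElementary (p q : ι) (a : A) (α : Aut A ι) : Prop :=
  p ≠ q ∧ α (Finsupp.single p 1) = Finsupp.single p 1 + Finsupp.single q a ∧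
    ∀ r, r ≠ p → α (Finsupp.single r 1) = Finsupp.single r 1

/-- `α` is the diagonal automorphism `b_p ↦ u • b_p`, fixing all other basis vectors. -/
def IsDiagonal (p : ι) (u : Aˣ) (α : Aut A ι) : Prop :=
  α (Finsupp.single p 1) = Finsupp.single p (u : A) ∧
    ∀ r, r ≠ p → α (Finsupp.single r 1) = Finsupp.single r 1

/-- The subgroup generated by the elementary automorphisms and the diagonal automorphisms with
entries in `T`, all of them involving only basis vectors with index in `F`. -/
def simpleOn (T : Subgroup Aˣ) (F : Set ι) : Subgroup (Aut A ι) :=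
  Subgroup.closure {α | (∃ p ∈ F, ∃ q ∈ F, ∃ a, IsElementary p q a α) ∨
    (∃ p ∈ F, ∃ u ∈ T, IsDiagonal p u α)}

/-- The group of simple automorphisms of the free module on the basis `ι`, relative to the group
`T` of trivial units. For `ι` countably infinite, this is the kernel of the torsion map
`GL(A) = ⋃ₙ GLₙ(A) → K₁(A) / T`, since `K₁(A)` is the quotient of `GL(A)` by the subgroup of
elementary automorphisms. In particular each of its elements fixes almost all basis vectors. For
`A = ℤ[π]` and `T = ±π` the group `K₁(A) / T` is the Whitehead group of `π`. -/
def simple (T : Subgroup Aˣ) (ι : Type*) : Subgroup (Aut A ι) := simpleOn T Set.univ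

end Simple

/-! ### Skew-quadratic forms -/

section Form

variable (A : Type*) [Ring A] [StarRing A]

/-- A form parameter on the ring with involution `A`, for the sign `ε = -1`: an additive subgroup
`Γ` with `{a + ā} ⊆ Γ ⊆ {a | a = ā}` and `a Γ ā ⊆ Γ` for all `a`. -/
structure FormParameter extends AddSubgroup A where
  add_star_mem' : ∀ a : A, a + star a ∈ carrier
  star_eq' : ∀ a ∈ carrier, star a = a
  conj_mem' : ∀ a : A, ∀ c ∈ carrier, a * c * star a ∈ carrier

variable {A}

/-- The underlying module of the stable hyperbolic form, with basis `e_i = inl i` and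
`f_i = inr i`, for `i : ℕ`. -/
abbrev Hyp (A : Type*) [Ring A] : Type _ := (ℕ ⊕ ℕ) →₀ A

/-- The basis vector `e_i`. -/
def e (i : ℕ) : Hyp A := Finsupp.single (Sum.inl i) 1

/-- The basis vector `f_i`. -/
def f (i : ℕ) : Hyp A := Finsupp.single (Sum.inr i) 1

/-- The sesquilinear form `h(x, y) = ∑ᵢ x(e_i) * star (y(f_i))`. -/
def halfForm (x y : Hyp A) : A :=
  x.sum fun p a => Sum.elim (fun i => a * star (y (Sum.inr i))) (fun _ => 0) p

/-- The skew-hermitian hyperbolic form `λ(x, y) = h(x, y) - star (h(y, x))`, so that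
`λ(e_i, f_i) = 1`, `λ(f_i, e_i) = -1`. -/
def lam (x y : Hyp A) : A := halfForm x y - star (halfForm y x)

/-- `α` is an isometry of the skew-quadratic hyperbolic form `(λ, μ)`, where the quadratic
refinement is `μ(x) = [h(x, x)] ∈ A / Γ`. -/
def IsIsometry (Γ : FormParameter A) (α : Aut A (ℕ ⊕ ℕ)) : Prop :=
  (∀ x y, lam (α x) (α y) = lam x y) ∧
    ∀ x, (QuotientAddGroup.mk (halfForm (α x) (α x)) : A ⧸ Γ.toAddSubgroup) =
      QuotientAddGroup.mk (halfForm x x)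

end Form

/-! ### Elementary and diagonal automorphisms, transport along maps of bases -/

section Simple

variable {A : Type*} [Ring A] {ι κ : Type*}

theorem aut_ext {α β : Aut A ι}
    (H : ∀ p, α (Finsupp.single p 1) = β (Finsupp.single p 1)) : α = β := by
  apply LinearEquiv.toLinearMap_injective
  apply Finsupp.lhom_ext'
  intro p
  apply LinearMap.ext_ring
  simpa using H p

theorem map_single (α : Aut A ι) (p : ι) (a : A) :
    α (Finsupp.single p a) = a • α (Finsupp.single p 1) := by
  rw [← map_smul, Finsupp.smul_single, smul_eq_mul, mul_one]

theorem exists_isElementary {p q : ι} (hpq : p ≠ q) (a : A) :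
    ∃ α : Aut A ι, IsElementary p q a α := by
  have h0 : (Finsupp.lapply p : (ι →₀ A) →ₗ[A] A) (Finsupp.single q a) = 0 := by
    simp [Finsupp.lapply_apply, hpq]
  refine ⟨LinearEquiv.transvection h0, hpq, ?_, ?_⟩
  · change Finsupp.single p 1 + (Finsupp.single p (1 : A) p) • Finsupp.single q a = _
    rw [Finsupp.single_eq_same, one_smul]
  · intro r hr
    simp [LinearEquiv.transvection, LinearMap.transvection, hr]

theorem exists_isDiagonal (p : ι) (u : Aˣ) : ∃ α : Aut A ι, IsDiagonal p u α := by
  classical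
  let d : Aˣ → (ι →₀ A) →ₗ[A] (ι →₀ A) := fun v =>
    Finsupp.lsum ℕ fun r => LinearMap.toSpanSingleton A _
      (Finsupp.single r (if r = p then (v : A) else 1))
  have hd : ∀ v r a, d v (Finsupp.single r a) =
      Finsupp.single r (a * (if r = p then (v : A) else 1)) := by
    intro v r a
    simp [d]
  have hdd : ∀ v w : Aˣ, v * w = 1 → d w ∘ₗ d v = LinearMap.id := by
    intro v w hvw
    have hvw' : (v : A) * (w : A) = 1 := by
      rw [← Units.val_mul, hvw, Units.val_one]
    apply Finsupp.lhom_ext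
    intro r a
    rw [LinearMap.comp_apply, hd, hd]
    by_cases hr : r = p
    · simp [hr, mul_assoc, hvw']
    · simp [hr]
  refine ⟨LinearEquiv.ofLinearMap (d u) (d u⁻¹) (hdd _ _ (by simp)) (hdd _ _ (by simp)), ?_, ?_⟩
  · rw [LinearEquiv.coe_ofLinearMap, hd]
    simp
  · intro r hr
    rw [LinearEquiv.coe_ofLinearMap, hd]
    simp [hr]

theorem simpleOn_mono (T : Subgroup Aˣ) {F F' : Set ι} (hF : F ⊆ F') :
    simpleOn T F ≤ simpleOn T F' := by
  apply Subgroup.closure_mono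
  rintro α (⟨p, hp, q, hq, a, ha⟩ | ⟨p, hp, u, hu, ha⟩)
  · exact Or.inl ⟨p, hF hp, q, hF hq, a, ha⟩
  · exact Or.inr ⟨p, hF hp, u, hu, ha⟩

theorem elementary_mem (T : Subgroup Aˣ) {p q : ι} {a : A} {α : Aut A ι}
    (hα : IsElementary p q a α) : α ∈ simple T ι :=
  Subgroup.subset_closure (Or.inl ⟨p, trivial, q, trivial, a, hα⟩)

/-- A simple automorphism only involves finitely many basis vectors. -/
theorem exists_simpleOn {T : Subgroup Aˣ} (F : ℕ → Set ι) (hF : Monotone F)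
    (hF' : ∀ p, ∃ n, p ∈ F n) {α : Aut A ι} (hα : α ∈ simple T ι) :
    ∃ n, α ∈ simpleOn T (F n) := by
  induction hα using Subgroup.closure_induction with
  | mem α hα =>
    rcases hα with ⟨p, -, q, -, a, ha⟩ | ⟨p, -, u, hu, ha⟩
    · obtain ⟨n, hn⟩ := hF' p
      obtain ⟨m, hm⟩ := hF' q
      exact ⟨max n m, Subgroup.subset_closure (Or.inl
        ⟨p, hF (le_max_left _ _) hn, q, hF (le_max_right _ _) hm, a, ha⟩)⟩
    · obtain ⟨n, hn⟩ := hF' p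
      exact ⟨n, Subgroup.subset_closure (Or.inr ⟨p, hn, u, hu, ha⟩)⟩
  | one => exact ⟨0, one_mem _⟩
  | mul x y _ _ hx hy =>
    obtain ⟨n, hn⟩ := hx
    obtain ⟨m, hm⟩ := hy
    exact ⟨max n m, mul_mem (simpleOn_mono T (hF (le_max_left _ _)) hn)
      (simpleOn_mono T (hF (le_max_right _ _)) hm)⟩
  | inv x _ hx =>
    obtain ⟨n, hn⟩ := hx
    exact ⟨n, inv_mem hn⟩

theorem aut_inv_apply (α : Aut A ι) (x : ι →₀ A) : α (α⁻¹ x) = x := by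
  change (α * α⁻¹) x = x
  rw [mul_inv_cancel]
  rfl

theorem aut_inv_eq {α : Aut A ι} {x y : ι →₀ A} (hxy : α x = y) : α⁻¹ y = x := by
  apply α.injective
  rw [aut_inv_apply, hxy]

theorem supported_ind {F : Set ι} {P : (ι →₀ A) → Prop} (h0 : P 0)
    (hadd : ∀ x y, P x → P y → P (x + y)) (hs : ∀ p ∈ F, ∀ a, P (Finsupp.single p a))
    {x : ι →₀ A} (hx : x ∈ Finsupp.supported A A F) : P x := by
  classical
  have hx' : (x.support : Set ι) ⊆ F := hx
  rw [← Finsupp.sum_single x]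
  unfold Finsupp.sum
  apply Finset.sum_induction _ P hadd h0
  intro p hp
  exact hs p (hx' hp) _

theorem simpleOn_props {T : Subgroup Aˣ} {F : Set ι} {α : Aut A ι} (hα : α ∈ simpleOn T F) :
    (∀ x ∈ Finsupp.supported A A F, α x ∈ Finsupp.supported A A F ∧
      α⁻¹ x ∈ Finsupp.supported A A F) ∧
    ∀ x ∈ Finsupp.supported A A Fᶜ, α x = x := by
  classical
  have hb : ∀ p ∈ F, ∀ a : A, Finsupp.single p a ∈ Finsupp.supported A A F :=
    fun p hp a => Finsupp.single_mem_supported A a hp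
  have key : ∀ β γ : Aut A ι, (∀ x, β (γ x) = x) → ∀ p ∈ F,
      (∀ r, r ≠ p → β (Finsupp.single r 1) = Finsupp.single r 1) →
      β (Finsupp.single p 1) ∈ Finsupp.supported A A F →
      ∀ x ∈ Finsupp.supported A A F, β x ∈ Finsupp.supported A A F := by
    intro β γ _ p hp h1 h2 x hx
    refine supported_ind (P := fun x => β x ∈ Finsupp.supported A A F) (by simp)
      (fun x y hx hy => by rw [map_add]; exact add_mem hx hy) ?_ hx
    intro r hr a
    rw [map_single]
    apply Submodule.smul_mem
    by_cases hrp : r = p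
    · rw [hrp]; exact h2
    · rw [h1 r hrp]; exact hb r hr 1
  induction hα using Subgroup.closure_induction with
  | mem α hα =>
    rcases hα with ⟨p, hp, q, hq, a, hpq, h1, h2⟩ | ⟨p, hp, u, hu, h1, h2⟩
    · have h3 : ∀ r, r ≠ p → α⁻¹ (Finsupp.single r 1) = Finsupp.single r 1 :=
        fun r hr => aut_inv_eq (h2 r hr)
      have h4 : α⁻¹ (Finsupp.single p 1) = Finsupp.single p 1 - Finsupp.single q a := by
        apply aut_inv_eq
        rw [map_sub, h1, map_single, h2 q hpq.symm]
        simp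
      refine ⟨fun x hx => ⟨?_, ?_⟩, fun x hx => ?_⟩
      · exact key α α⁻¹ (aut_inv_apply α) p hp h2
          (by rw [h1]; exact add_mem (hb p hp 1) (hb q hq a)) x hx
      · exact key α⁻¹ α (fun x => aut_inv_eq rfl) p hp h3
          (by rw [h4]; exact sub_mem (hb p hp 1) (hb q hq a)) x hx
      · refine supported_ind (P := fun x => α x = x) (by simp)
          (fun x y hx hy => by rw [map_add, hx, hy]) ?_ hx
        intro r hr a
        rw [map_single, h2 r (fun hrp => hr (hrp ▸ hp))]
        simp
    · have h3 : ∀ r, r ≠ p → α⁻¹ (Finsupp.single r 1) = Finsupp.single r 1 :=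
        fun r hr => aut_inv_eq (h2 r hr)
      have h4 : α⁻¹ (Finsupp.single p 1) = Finsupp.single p ((u⁻¹ : Aˣ) : A) := by
        apply aut_inv_eq
        rw [map_single, h1]
        simp
      refine ⟨fun x hx => ⟨?_, ?_⟩, fun x hx => ?_⟩
      · exact key α α⁻¹ (aut_inv_apply α) p hp h2 (by rw [h1]; exact hb p hp _) x hx
      · exact key α⁻¹ α (fun x => aut_inv_eq rfl) p hp h3
          (by rw [h4]; exact hb p hp _) x hx
      · refine supported_ind (P := fun x => α x = x) (by simp)
          (fun x y hx hy => by rw [map_add, hx, hy]) ?_ hx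
        intro r hr a
        rw [map_single, h2 r (fun hrp => hr (hrp ▸ hp))]
        simp
  | one => exact ⟨fun x hx => ⟨hx, by rw [inv_one]; exact hx⟩, fun x _ => rfl⟩
  | mul α β _ _ iα iβ =>
    refine ⟨fun x hx => ⟨(iα.1 _ (iβ.1 x hx).1).1, ?_⟩, fun x hx => ?_⟩
    · rw [mul_inv_rev]
      exact (iβ.1 _ (iα.1 x hx).2).2
    · change α (β x) = x
      rw [iβ.2 x hx, iα.2 x hx]
  | inv α _ iα =>
    refine ⟨fun x hx => ⟨(iα.1 x hx).2, by rw [inv_inv]; exact (iα.1 x hx).1⟩, fun x hx => ?_⟩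
    exact aut_inv_eq (iα.2 x hx)

/-- Transport of simple automorphisms along a map of bases, up to signs. -/
theorem transport {T : Subgroup Aˣ} {F : Set ι} (k : ι → κ) (hk : Set.InjOn k F)
    (s : ι → A) (hs : ∀ p, s p = 1 ∨ s p = -1) (K : (ι →₀ A) →ₗ[A] (κ →₀ A))
    (hK : ∀ p a, K (Finsupp.single p a) = Finsupp.single (k p) (a * s p))
    {α : Aut A ι} (hα : α ∈ simpleOn T F) :
    ∃ β ∈ simple T κ, (∀ x ∈ Finsupp.supported A A F, β (K x) = K (α x)) ∧
      ∀ q, q ∉ k '' F → β (Finsupp.single q 1) = Finsupp.single q 1 := by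
  have hss : ∀ p, s p * s p = 1 := fun p => by rcases hs p with h | h <;> simp [h]
  have hKF : ∀ (α : Aut A ι) (β : Aut A κ),
      (∀ p ∈ F, β (Finsupp.single (k p) 1) = s p • K (α (Finsupp.single p 1))) →
      ∀ x ∈ Finsupp.supported A A F, β (K x) = K (α x) := by
    intro α β H x hx
    refine supported_ind (P := fun x => β (K x) = K (α x)) (by simp)
      (fun x y hx hy => by simp only [map_add, hx, hy]) ?_ hx
    intro p hp a
    rw [hK, map_single, H p hp, smul_smul, mul_assoc, hss, mul_one, map_single α p a, map_smul]
  induction hα using Subgroup.closure_induction with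
  | mem α hα =>
    rcases hα with ⟨p, hp, q, hq, a, hpq, h1, h2⟩ | ⟨p, hp, u, hu, h1, h2⟩
    · have hkpq : k p ≠ k q := fun H => hpq (hk hp hq H)
      obtain ⟨β, hβ⟩ := exists_isElementary hkpq (s p * a * s q)
      refine ⟨β, elementary_mem T hβ, hKF _ _ ?_, ?_⟩
      · intro r hr
        by_cases hrp : r = p
        · subst hrp
          rw [hβ.2.1, h1, map_add, hK, hK, smul_add, Finsupp.smul_single, Finsupp.smul_single,
            smul_eq_mul, smul_eq_mul, one_mul, hss, mul_assoc]
        · rw [hβ.2.2 _ (fun H => hrp (hk hr hp H)), h2 r hrp, hK]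
          simp [hss]
      · intro r hr
        exact hβ.2.2 r (fun H => hr ⟨p, hp, H.symm⟩)
    · obtain ⟨β, hβ⟩ := exists_isDiagonal (k p) u
      refine ⟨β, Subgroup.subset_closure (Or.inr ⟨_, trivial, u, hu, hβ⟩), hKF _ _ ?_, ?_⟩
      · intro r hr
        by_cases hrp : r = p
        · subst hrp
          rw [hβ.1, h1, hK]
          rcases hs r with h | h <;> simp [h]
        · rw [hβ.2 _ (fun H => hrp (hk hr hp H)), h2 r hrp, hK]
          simp [hss]
      · intro r hr
        exact hβ.2 r (fun H => hr ⟨p, hp, H.symm⟩)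
  | one => exact ⟨1, one_mem _, fun x _ => rfl, fun q _ => rfl⟩
  | mul α γ _ hγ iα iγ =>
    obtain ⟨β, hβ, h1, h2⟩ := iα
    obtain ⟨δ, hδ, h3, h4⟩ := iγ
    refine ⟨β * δ, mul_mem hβ hδ, fun x hx => ?_, fun q hq => ?_⟩
    · change β (δ (K x)) = K (α (γ x))
      rw [h3 x hx, h1 _ ((simpleOn_props hγ).1 x hx).1]
    · change β (δ _) = _
      rw [h4 q hq, h2 q hq]
  | inv α hα iα =>
    obtain ⟨β, hβ, h1, h2⟩ := iα
    refine ⟨β⁻¹, inv_mem hβ, fun x hx => ?_, fun q hq => aut_inv_eq (h2 q hq)⟩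
    apply aut_inv_eq
    rw [h1 _ ((simpleOn_props hα).1 x hx).2, aut_inv_apply]

end Simple

/-! ### Isometries of the hyperbolic form -/

section Form

variable {A : Type*} [Ring A] [StarRing A]

theorem halfForm_add_left (x x' y : Hyp A) :
    halfForm (x + x') y = halfForm x y + halfForm x' y := by
  unfold halfForm
  rw [Finsupp.sum_add_index'] <;> rintro (i | i) <;> simp [add_mul]

theorem halfForm_smul_left (a : A) (x y : Hyp A) : halfForm (a • x) y = a * halfForm x y := by
  unfold halfForm
  rw [Finsupp.sum_smul_index (by rintro (i | i) <;> simp), Finsupp.mul_sum]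
  apply Finsupp.sum_congr
  rintro (i | i) - <;> simp [mul_assoc]

theorem halfForm_add_right (x y y' : Hyp A) :
    halfForm x (y + y') = halfForm x y + halfForm x y' := by
  unfold halfForm
  rw [← Finsupp.sum_add]
  apply Finsupp.sum_congr
  rintro (i | i) - <;> simp [mul_add]

theorem halfForm_smul_right (a : A) (x y : Hyp A) :
    halfForm x (a • y) = halfForm x y * star a := by
  unfold halfForm
  rw [Finsupp.sum_mul]
  apply Finsupp.sum_congr
  rintro (i | i) - <;> simp [mul_assoc]

theorem halfForm_zero_left (y : Hyp A) : halfForm 0 y = 0 := by simp [halfForm]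

theorem halfForm_zero_right (x : Hyp A) : halfForm x 0 = 0 := by
  have := halfForm_add_right x 0 0
  simpa using this

theorem halfForm_single (p q : ℕ ⊕ ℕ) :
    halfForm (Finsupp.single p 1 : Hyp A) (Finsupp.single q 1) =
      if p.isLeft ∧ q = p.swap then 1 else 0 := by
  unfold halfForm
  rcases p with i | i <;> rcases q with j | j <;> simp [Finsupp.single_apply]
  split_ifs <;> simp

theorem lam_single (p q : ℕ ⊕ ℕ) :
    lam (Finsupp.single p 1 : Hyp A) (Finsupp.single q 1) =
      if q = p.swap then (if p.isLeft then 1 else -1) else 0 := by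
  rcases p with i | i <;> rcases q with j | j <;> simp [lam, halfForm_single]
  by_cases hij : j = i
  · simp [hij]
  · simp [hij, Ne.symm hij]

theorem lam_add_left (x x' y : Hyp A) : lam (x + x') y = lam x y + lam x' y := by
  simp only [lam, halfForm_add_left, halfForm_add_right, star_add]; abel

theorem lam_add_right (x y y' : Hyp A) : lam x (y + y') = lam x y + lam x y' := by
  simp only [lam, halfForm_add_left, halfForm_add_right, star_add]; abel

theorem lam_smul_left (a : A) (x y : Hyp A) : lam (a • x) y = a * lam x y := by
  simp only [lam, halfForm_smul_left, halfForm_smul_right, star_mul, star_star, mul_sub]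

theorem lam_smul_right (a : A) (x y : Hyp A) : lam x (a • y) = lam x y * star a := by
  simp only [lam, halfForm_smul_left, halfForm_smul_right, star_mul, sub_mul]

theorem lam_neg (x y : Hyp A) : lam y x = - star (lam x y) := by
  simp [lam]

theorem mk_eq_iff (Γ : FormParameter A) (a b : A) :
    (QuotientAddGroup.mk a : A ⧸ Γ.toAddSubgroup) = QuotientAddGroup.mk b ↔
      a - b ∈ Γ.toAddSubgroup := by
  rw [eq_comm, QuotientAddGroup.eq, neg_add_eq_sub]

theorem halfForm_symm (Γ : FormParameter A) (x y : Hyp A) :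
    halfForm x y + halfForm y x - lam x y ∈ Γ.toAddSubgroup := by
  have : halfForm x y + halfForm y x - lam x y = halfForm y x + star (halfForm y x) := by
    simp only [lam]; abel
  rw [this]
  exact Γ.add_star_mem' _

theorem halfForm_single_self (p : ℕ ⊕ ℕ) (a : A) :
    halfForm (Finsupp.single p a) (Finsupp.single p a) = 0 := by
  unfold halfForm
  rcases p with i | i <;> simp

/-- It suffices to check the isometry condition on the standard basis. -/
theorem isIsometry_of_basis (Γ : FormParameter A) (α : Aut A (ℕ ⊕ ℕ))
    (h1 : ∀ p q, lam (α (Finsupp.single p 1)) (α (Finsupp.single q 1)) =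
      lam (Finsupp.single p 1) (Finsupp.single q 1))
    (h2 : ∀ p, halfForm (α (Finsupp.single p 1)) (α (Finsupp.single p 1)) ∈ Γ.toAddSubgroup) :
    IsIsometry Γ α := by
  have l0 : ∀ y : Hyp A, lam 0 y = 0 := fun y => by
    simp [lam, halfForm_zero_left, halfForm_zero_right]
  have r0 : ∀ y : Hyp A, lam y 0 = 0 := fun y => by
    simp [lam, halfForm_zero_left, halfForm_zero_right]
  have hs : ∀ (p : ℕ ⊕ ℕ) (a : A), Finsupp.single p a = a • (Finsupp.single p 1 : Hyp A) := by
    intro p a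
    rw [Finsupp.smul_single, smul_eq_mul, mul_one]
  have h3 : ∀ x y, lam (α x) (α y) = lam x y := by
    intro x y
    induction x using Finsupp.induction_linear with
    | zero => rw [map_zero, l0, l0]
    | add x x' hx hx' => rw [map_add, lam_add_left, lam_add_left, hx, hx']
    | single p a =>
      induction y using Finsupp.induction_linear with
      | zero => rw [map_zero, r0, r0]
      | add x x' hx hx' => rw [map_add α x, lam_add_right, lam_add_right, hx, hx']
      | single q b =>
        rw [hs p a, hs q b, map_smul, map_smul, lam_smul_left, lam_smul_left, lam_smul_right,
          lam_smul_right, h1]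
  refine ⟨h3, fun x => ?_⟩
  rw [mk_eq_iff]
  induction x using Finsupp.induction_linear with
  | zero => rw [map_zero, sub_self]; exact zero_mem _
  | add x y hx hy =>
    have e1 := halfForm_symm Γ (α x) (α y)
    have e2 := halfForm_symm Γ x y
    rw [h3] at e1
    have := add_mem (add_mem hx hy) (sub_mem e1 e2)
    convert this using 1
    simp only [map_add, halfForm_add_left, halfForm_add_right]
    abel
  | single p a =>
    rw [halfForm_single_self, hs p a, map_smul, sub_zero, halfForm_smul_left,
      halfForm_smul_right, ← mul_assoc]
    exact Γ.conj_mem' _ _ (h2 p)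

end Form

/-! ### The odd-dimensional L-group -/

section Lagr

variable {A : Type*} [Ring A]

/-- The inclusion of the standard Lagrangian, spanned by the `e_i`. -/
def lagr : (ℕ →₀ A) →ₗ[A] Hyp A := Finsupp.lmapDomain A A Sum.inl

/-- `α` maps the standard Lagrangian to itself by a simple automorphism. -/
def PreservesLagr (T : Subgroup Aˣ) (α : Aut A (ℕ ⊕ ℕ)) : Prop :=
  ∃ β ∈ simple T ℕ, ∀ x, α (lagr x) = lagr (β x)

/-- `α` is the flip of the `i`-th hyperbolic plane: `e_i ↦ f_i`, `f_i ↦ -e_i`. -/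
def IsFlip (i : ℕ) (α : Aut A (ℕ ⊕ ℕ)) : Prop :=
  α (e i) = f i ∧ α (f i) = -e i ∧ ∀ j, j ≠ i → α (e j) = e j ∧ α (f j) = f j

theorem lagr_single (i : ℕ) (a : A) :
    lagr (Finsupp.single i a) = Finsupp.single (Sum.inl i) a := by
  simp [lagr]

theorem exists_isFlip (T : Subgroup Aˣ) (i : ℕ) : ∃ α ∈ simple T (ℕ ⊕ ℕ), IsFlip i α := by
  obtain ⟨x, hx⟩ := exists_isElementary (A := A)
    (show (Sum.inl i : ℕ ⊕ ℕ) ≠ Sum.inr i by simp) 1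
  obtain ⟨y, hy⟩ := exists_isElementary (A := A)
    (show (Sum.inr i : ℕ ⊕ ℕ) ≠ Sum.inl i by simp) (-1)
  refine ⟨x * y * x, mul_mem (mul_mem (elementary_mem T hx) (elementary_mem T hy))
    (elementary_mem T hx), ?_⟩
  obtain ⟨-, x1, x2⟩ := hx
  obtain ⟨-, y1, y2⟩ := hy
  have x3 := x2 (Sum.inr i) (by simp)
  have y3 := y2 (Sum.inl i) (by simp)
  unfold IsFlip e f
  refine ⟨?_, ?_, fun j hj => ⟨?_, ?_⟩⟩ <;> change x (y (x _)) = _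
  · rw [x1, map_add, y3, y1, map_add, map_add, Finsupp.single_neg, map_neg, x1, x3]
    abel
  · rw [x3, y1, map_add, Finsupp.single_neg, map_neg, x1, x3]
    abel
  · rw [x2 _ (by simpa using hj), y2 _ (by simp), x2 _ (by simpa using hj)]
  · rw [x2 _ (by simp), y2 _ (by simpa using hj), x2 _ (by simp)]

theorem isFlip_simple (T : Subgroup Aˣ) {i : ℕ} {α : Aut A (ℕ ⊕ ℕ)} (hα : IsFlip i α) :
    α ∈ simple T (ℕ ⊕ ℕ) := by
  obtain ⟨β, hβ, b1, b2, b3⟩ := exists_isFlip T i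
  obtain ⟨a1, a2, a3⟩ := hα
  have : α = β := by
    apply aut_ext
    rintro (j | j) <;> by_cases hj : j = i
    · subst hj; exact a1.trans b1.symm
    · exact (a3 j hj).1.trans (b3 j hj).1.symm
    · subst hj; exact a2.trans b2.symm
    · exact (a3 j hj).2.trans (b3 j hj).2.symm
  exact this ▸ hβ

end Lagr

section LGroup

variable {A : Type*} [Ring A] [StarRing A]

/-- The stable special unitary group `SU(A) = ⋃ᵣ SUᵣ(A)`: the simple isometries of the
skew-quadratic hyperbolic form. -/
def SU (T : Subgroup Aˣ) (Γ : FormParameter A) : Subgroup (Aut A (ℕ ⊕ ℕ)) where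
  carrier := {α | α ∈ simple T (ℕ ⊕ ℕ) ∧ IsIsometry Γ α}
  one_mem' := ⟨one_mem _, fun _ _ => rfl, fun _ => rfl⟩
  mul_mem' := fun {α β} hα hβ => ⟨mul_mem hα.1 hβ.1,
    fun x y => (hα.2.1 (β x) (β y)).trans (hβ.2.1 x y),
    fun x => (hα.2.2 (β x)).trans (hβ.2.2 x)⟩
  inv_mem' := fun {α} hα => ⟨inv_mem hα.1,
    fun x y => by simpa only [aut_inv_apply] using (hα.2.1 (α⁻¹ x) (α⁻¹ y)).symm,
    fun x => by simpa only [aut_inv_apply] using (hα.2.2 (α⁻¹ x)).symm⟩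

/-- The subgroup `RU(A)` generated by the elements of `SU(A)` which map the standard Lagrangian to
itself by a simple automorphism, and by the flips of hyperbolic planes. (All flips are conjugate to
the flip of one plane by permutations of the planes, which preserve the Lagrangian.) It is a normal
subgroup of `SU(A)`, see `RU_normal`. -/
def RU (T : Subgroup Aˣ) (Γ : FormParameter A) : Subgroup (Aut A (ℕ ⊕ ℕ)) :=
  Subgroup.closure {α | (α ∈ SU T Γ ∧ PreservesLagr T α) ∨ ∃ i, IsFlip i α}

theorem isFlip_mem {T : Subgroup Aˣ} (Γ : FormParameter A) {i : ℕ} {α : Aut A (ℕ ⊕ ℕ)}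
    (hα : IsFlip i α) : α ∈ SU T Γ := by
  obtain ⟨h1, h2, h3⟩ := id hα
  unfold e f at h1 h2
  have h4 : ∀ j, j ≠ i → α (Finsupp.single (Sum.inl j) 1) = Finsupp.single (Sum.inl j) 1 :=
    fun j hj => (h3 j hj).1
  have h5 : ∀ j, j ≠ i → α (Finsupp.single (Sum.inr j) 1) = Finsupp.single (Sum.inr j) 1 :=
    fun j hj => (h3 j hj).2
  refine ⟨isFlip_simple T hα, isIsometry_of_basis Γ α ?_ ?_⟩
  · have hn : ∀ x y : Hyp A, lam (-x) y = - lam x y := fun x y => by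
      simpa using lam_smul_left (-1) x y
    have hn' : ∀ x y : Hyp A, lam x (-y) = - lam x y := fun x y => by
      simpa using lam_smul_right (-1) x y
    rintro (j | j) (k | k) <;> by_cases hj : j = i <;> by_cases hk : k = i <;>
      first
      | (subst hj; subst hk; simp [h1, h2, hn, hn', lam_single])
      | (subst hj; simp [h1, h2, h4 k hk, h5 k hk, hn, lam_single, hk])
      | (subst hk; simp [h1, h2, h4 j hj, h5 j hj, hn', lam_single, Ne.symm hj])
      | (simp [h4 j hj, h5 j hj, h4 k hk, h5 k hk])
  · rintro (j | j) <;> by_cases hj : j = i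
    · subst hj
      rw [h1, halfForm_single_self]; exact zero_mem _
    · rw [h4 j hj, halfForm_single_self]; exact zero_mem _
    · subst hj
      rw [h2, ← Finsupp.single_neg, halfForm_single_self]; exact zero_mem _
    · rw [h5 j hj, halfForm_single_self]; exact zero_mem _

theorem RU_le_SU (T : Subgroup Aˣ) (Γ : FormParameter A) : RU T Γ ≤ SU T Γ := by
  rw [RU, Subgroup.closure_le]
  rintro α (h | ⟨i, h⟩)
  · exact h.1
  · exact isFlip_mem Γ h

/-! The subgroup `RU` is normal in `SU`. -/

theorem exists_hyp (T : Subgroup Aˣ) (Γ : FormParameter A) {i j : ℕ} (hij : i ≠ j) :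
    ∃ α ∈ RU T Γ, α (e i) = e i + e j ∧ α (f j) = f j - f i ∧
      (∀ k, k ≠ i → α (e k) = e k) ∧ ∀ k, k ≠ j → α (f k) = f k := by
  obtain ⟨x, hx⟩ := exists_isElementary (A := A)
    (show (Sum.inl i : ℕ ⊕ ℕ) ≠ Sum.inl j by simpa using hij) 1
  obtain ⟨y, hy⟩ := exists_isElementary (A := A)
    (show (Sum.inr j : ℕ ⊕ ℕ) ≠ Sum.inr i by simpa using hij.symm) (-1)
  obtain ⟨b, hb⟩ := exists_isElementary (A := A) hij 1
  have hS : x * y ∈ simple T (ℕ ⊕ ℕ) := mul_mem (elementary_mem T hx) (elementary_mem T hy)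
  obtain ⟨-, x1, x2⟩ := hx
  obtain ⟨-, y1, y2⟩ := hy
  have h1 : (x * y) (e i) = e i + e j := by
    change x (y _) = _
    unfold e
    rw [y2 _ (by simp), x1]
  have h2 : (x * y) (f j) = f j - f i := by
    change x (y _) = _
    unfold f
    rw [y1, map_add, Finsupp.single_neg, map_neg, x2 _ (by simp), x2 _ (by simp), sub_eq_add_neg]
  have h3 : ∀ k, k ≠ i → (x * y) (e k) = e k := fun k hk => by
    change x (y _) = _
    unfold e
    rw [y2 _ (by simp), x2 _ (by simpa using hk)]
  have h4 : ∀ k, k ≠ j → (x * y) (f k) = f k := fun k hk => by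
    change x (y _) = _
    unfold f
    rw [y2 _ (by simpa using hk), x2 _ (by simp)]
  have hhe : ∀ (k : ℕ) (v : Hyp A), halfForm (e k) v = star (v (Sum.inr k)) := by
    intro k v
    simp [halfForm, e]
  have hhf : ∀ (k : ℕ) (v : Hyp A), halfForm (f k) v = 0 := by
    intro k v
    simp [halfForm, f]
  refine ⟨x * y, Subgroup.subset_closure (Or.inl ⟨⟨hS, ?_⟩, b, elementary_mem T hb, ?_⟩),
    h1, h2, h3, h4⟩
  · have hee : ∀ k, ∃ v : ℕ →₀ A, (x * y) (e k) = lagr v := by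
      intro k
      by_cases hk : k = i
      · exact ⟨Finsupp.single i 1 + Finsupp.single j 1, by
          rw [hk, h1, map_add, lagr_single, lagr_single]; rfl⟩
      · exact ⟨Finsupp.single k 1, by rw [h3 k hk, lagr_single]; rfl⟩
    have hff : ∀ (u : Hyp A) k, halfForm ((x * y) (f k)) u = 0 := by
      intro u k
      by_cases hk : k = j
      · have := halfForm_add_left (f j - f i) (f i) u
        rw [sub_add_cancel, hhf, hhf, add_zero] at this
        rw [hk, h2, ← this]
      · rw [h4 k hk, hhf]
    have hel : ∀ (u : Hyp A) k, halfForm u ((x * y) (e k)) = 0 := by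
      intro u k
      obtain ⟨v, hv⟩ := hee k
      rw [hv]
      have : ∀ l, lagr v (Sum.inr l) = 0 := by
        intro l
        rw [lagr, Finsupp.lmapDomain_apply]
        exact Finsupp.mapDomain_of_notMem_range _ _ (by simp)
      unfold halfForm
      apply Finset.sum_eq_zero
      rintro (l | l) - <;> simp [this]
    have hef : ∀ k l, halfForm ((x * y) (e k)) ((x * y) (f l)) = halfForm (e k) (f l) := by
      intro k l
      by_cases hk : k = i <;> by_cases hl : l = j
      · subst hk; subst hl
        rw [h1, h2, halfForm_add_left, hhe, hhe, hhe]
        simp [f, hij, hij.symm]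
      · subst hk
        rw [h1, h4 l hl, halfForm_add_left, hhe, hhe]
        simp [f, Ne.symm hl]
      · subst hl
        rw [h3 k hk, h2, hhe, hhe]
        simp [f, hk]
      · rw [h3 k hk, h4 l hl]
    apply isIsometry_of_basis
    · rintro (k | k) (l | l) <;> simp only [lam]
      · change halfForm ((x * y) (e k)) ((x * y) (e l)) - star (halfForm ((x * y) (e l))
          ((x * y) (e k))) = halfForm (e k) (e l) - star (halfForm (e l) (e k))
        rw [hel, hel, hhe, hhe]
        simp [e]
      · change halfForm ((x * y) (e k)) ((x * y) (f l)) - star (halfForm ((x * y) (f l))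
          ((x * y) (e k))) = halfForm (e k) (f l) - star (halfForm (f l) (e k))
        rw [hef, hff, hhf]
      · change halfForm ((x * y) (f k)) ((x * y) (e l)) - star (halfForm ((x * y) (e l))
          ((x * y) (f k))) = halfForm (f k) (e l) - star (halfForm (e l) (f k))
        rw [hef, hff, hhf]
      · change halfForm ((x * y) (f k)) ((x * y) (f l)) - star (halfForm ((x * y) (f l))
          ((x * y) (f k))) = halfForm (f k) (f l) - star (halfForm (f l) (f k))
        rw [hff, hff, hhf, hhf]
    · rintro (k | k)
      · change halfForm ((x * y) (e k)) ((x * y) (e k)) ∈ _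
        rw [hel]; exact zero_mem _
      · change halfForm ((x * y) (f k)) ((x * y) (f k)) ∈ _
        rw [hff]; exact zero_mem _
  · obtain ⟨-, b1, b2⟩ := hb
    intro v
    induction v using Finsupp.induction_linear with
    | zero => simp
    | add v w hv hw => simp only [map_add, hv, hw]
    | single k a =>
      rw [lagr_single, map_single, map_single b, map_smul]
      congr 1
      by_cases hk : k = i
      · subst hk
        rw [b1, map_add, lagr_single, lagr_single]
        exact h1
      · rw [b2 k hk, lagr_single]
        exact h3 k hk

theorem exists_diag (T : Subgroup Aˣ) (Γ : FormParameter A) (m n : ℕ) (hn : n ≤ m) :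
    ∃ θ ∈ RU T Γ, (∀ i < n, θ (e i) = e i + e (i + m) ∧ θ (e (i + m)) = f i - f (i + m)) ∧
      ∀ j, ¬ j < n → ¬ (m ≤ j ∧ j < m + n) → θ (e j) = e j ∧ θ (f j) = f j := by
  induction n with
  | zero => exact ⟨1, one_mem _, by simp, fun j _ _ => ⟨rfl, rfl⟩⟩
  | succ n ih =>
    obtain ⟨θ, hθ, t1, t2⟩ := ih (by omega)
    obtain ⟨x, hx, x1, x2, x3, x4⟩ := exists_hyp T Γ (show n ≠ n + m by omega)
    obtain ⟨s, -, hs⟩ := exists_isFlip T (n + m)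
    have hs' : s ∈ RU T Γ := Subgroup.subset_closure (Or.inr ⟨_, hs⟩)
    obtain ⟨-, s2, s3⟩ := hs
    refine ⟨θ * (x * s⁻¹), mul_mem hθ (mul_mem hx (inv_mem hs')), ?_, ?_⟩
    · intro i hi
      change θ (x (s⁻¹ _)) = _ ∧ θ (x (s⁻¹ _)) = _
      by_cases hin : i = n
      · subst hin
        rw [aut_inv_eq (s3 i (by omega)).1, x1, map_add, (t2 i (by omega) (by omega)).1,
          (t2 (i + m) (by omega) (by omega)).1,
          aut_inv_eq (show s (- f (i + m)) = e (i + m) by rw [map_neg, s2, neg_neg]),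
          map_neg, x2, neg_sub, map_sub, (t2 i (by omega) (by omega)).2,
          (t2 (i + m) (by omega) (by omega)).2]
        exact ⟨rfl, rfl⟩
      · rw [aut_inv_eq (s3 i (by omega)).1, aut_inv_eq (s3 (i + m) (by omega)).1,
          x3 i (by omega), x3 (i + m) (by omega)]
        exact t1 i (by omega)
    · intro j hj hj'
      change θ (x (s⁻¹ _)) = _ ∧ θ (x (s⁻¹ _)) = _
      rw [aut_inv_eq (s3 j (by omega)).1, aut_inv_eq (s3 j (by omega)).2, x3 j (by omega),
        x4 j (by omega)]
      exact t2 j (by omega) (by omega)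

/-- The basis vectors of the first `m` hyperbolic planes. -/
def block (m : ℕ) : Set (ℕ ⊕ ℕ) := {p | Sum.elim id id p < m}

theorem block_mono : Monotone block := fun m n hmn p (hp : _ < m) =>
  show Sum.elim id id p < n from lt_of_lt_of_le hp hmn

theorem exists_mem_block (p : ℕ ⊕ ℕ) : ∃ n, p ∈ block n := ⟨_, Nat.lt_succ_self _⟩

/-- For `α` in `SU(A)` supported in the first `m` hyperbolic planes there is `α'` in `SU(A)`,
supported in the next `m` hyperbolic planes, with `α * α'` in `RU(A)`. -/
theorem exists_double {T : Subgroup Aˣ} {Γ : FormParameter A} {m : ℕ} {α : Aut A (ℕ ⊕ ℕ)}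
    (hα : α ∈ SU T Γ) (hαm : α ∈ simpleOn T (block m)) :
    ∃ α' : Aut A (ℕ ⊕ ℕ), (∀ x ∈ Finsupp.supported A A (block m), α' x = x) ∧
      (∀ p, p ∉ block m →
        α' (Finsupp.single p 1) ∈ Finsupp.supported A A (block m)ᶜ) ∧ α * α' ∈ RU T Γ := by
  obtain ⟨k, hk⟩ : ∃ k : ℕ ⊕ ℕ → ℕ ⊕ ℕ, k = Sum.map (· + m) (· + m) := ⟨_, rfl⟩
  have hkl : ∀ i, k (Sum.inl i) = Sum.inl (i + m) := fun i => by rw [hk]; rfl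
  have hkr : ∀ i, k (Sum.inr i) = Sum.inr (i + m) := fun i => by rw [hk]; rfl
  have hkinj : Function.Injective k := by
    rintro (i | i) (j | j) <;> simp [hkl, hkr]
  have hksw : ∀ p, (k p).swap = k p.swap := by rintro (i | i) <;> simp [hkl, hkr]
  have hkm : ∀ p, k p ∉ block m := by
    rintro (i | i) <;> simp [hkl, hkr, block]
  have hkleft : ∀ p, (k p).isLeft = p.isLeft := by rintro (i | i) <;> simp [hkl, hkr]
  obtain ⟨s, hs⟩ : ∃ s : ℕ ⊕ ℕ → A, s = Sum.elim (fun _ => 1) (fun _ => -1) := ⟨_, rfl⟩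
  have hsl : ∀ i, s (Sum.inl i) = 1 := fun i => by rw [hs]; rfl
  have hsr : ∀ i, s (Sum.inr i) = -1 := fun i => by rw [hs]; rfl
  have hss : ∀ p, s p * s p = 1 := by rintro (i | i) <;> simp [hsl, hsr]
  let τ : Hyp A →ₗ[A] Hyp A := Finsupp.lsum ℕ fun p =>
    LinearMap.toSpanSingleton A _ (Finsupp.single (k p) (s p))
  have hτ : ∀ p a, τ (Finsupp.single p a) = Finsupp.single (k p) (a * s p) := by
    intro p a
    simp [τ]
  have hτ1 : ∀ p, Finsupp.single (k p) (1 : A) = s p • τ (Finsupp.single p 1) := by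
    intro p
    rw [hτ, Finsupp.smul_single, smul_eq_mul, one_mul, hss]
  have hτc : ∀ x, τ x ∈ Finsupp.supported A A (block m)ᶜ := by
    intro x
    induction x using Finsupp.induction_linear with
    | zero => simp
    | add x y hx hy => rw [map_add]; exact add_mem hx hy
    | single p a =>
      rw [hτ]
      exact Finsupp.single_mem_supported A _ (hkm p)
  have hsg : ∀ (p : ℕ ⊕ ℕ) (a : A), Finsupp.single p a = a • (Finsupp.single p 1 : Hyp A) := by
    intro p a
    rw [Finsupp.smul_single, smul_eq_mul, mul_one]
  have hh : ∀ x y, halfForm (τ x) (τ y) = - halfForm x y := by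
    intro x y
    induction x using Finsupp.induction_linear with
    | zero => simp [halfForm_zero_left]
    | add x x' hx hx' => rw [map_add, halfForm_add_left, halfForm_add_left, hx, hx', neg_add]
    | single p a =>
      induction y using Finsupp.induction_linear with
      | zero => simp [halfForm_zero_right]
      | add x x' hx hx' =>
        rw [map_add, halfForm_add_right, halfForm_add_right, hx, hx', neg_add]
      | single q b =>
        rw [hτ, hτ, hsg, hsg (k q), hsg p a, hsg q b, halfForm_smul_left, halfForm_smul_left,
          halfForm_smul_right, halfForm_smul_right, halfForm_single, halfForm_single, hkleft, hksw]
        simp only [hkinj.eq_iff]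
        split_ifs with hpq
        · obtain ⟨h1, h2⟩ := hpq
          rcases p with i | i
          · simp [hsl, h2, hsr]
          · simp at h1
        · simp
  have hl : ∀ x y, lam (τ x) (τ y) = - lam x y := by
    intro x y
    rw [lam, lam, hh, hh, star_neg]; abel
  have hl0 : ∀ x ∈ Finsupp.supported A A (block m), ∀ q, q ∉ k '' block m →
      lam (τ x) (Finsupp.single q 1) = 0 := by
    intro x hx q hq
    refine supported_ind (P := fun x => lam (τ x) (Finsupp.single q 1) = 0) ?_ ?_ ?_ hx
    · simp [lam, halfForm_zero_left, halfForm_zero_right]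
    · intro x y hx hy
      rw [map_add, lam_add_left, hx, hy, add_zero]
    · intro r hr a
      rw [hτ, hsg, lam_smul_left, lam_single, if_neg, mul_zero]
      intro H
      refine hq ⟨r.swap, ?_, by rw [H, hksw]⟩
      rcases r with i | i <;> exact hr
  have hb : ∀ p ∈ block m, (Finsupp.single p 1 : Hyp A) ∈ Finsupp.supported A A (block m) :=
    fun p hp => Finsupp.single_mem_supported A 1 hp
  have hps := simpleOn_props hαm
  obtain ⟨α', hα', a1, a2⟩ := transport k hkinj.injOn s
    (by rintro (i | i) <;> simp [hsl, hsr]) τ hτ hαm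
  have a3 : ∀ p ∈ block m,
      α' (Finsupp.single (k p) 1) = s p • τ (α (Finsupp.single p 1)) := by
    intro p hp
    rw [hτ1, map_smul, a1 _ (hb p hp)]
  have a4 : ∀ x ∈ Finsupp.supported A A (block m), α' x = x := by
    intro x hx
    refine supported_ind (P := fun x => α' x = x) (by simp)
      (fun x y hx hy => by rw [map_add, hx, hy]) ?_ hx
    intro p hp a
    rw [map_single, a2, ← hsg]
    rintro ⟨q, -, rfl⟩
    exact hkm q hp
  have hiso : IsIsometry Γ α' := by
    apply isIsometry_of_basis
    · intro p q
      by_cases hp : p ∈ k '' block m <;> by_cases hq : q ∈ k '' block m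
      · obtain ⟨p, hp, rfl⟩ := hp
        obtain ⟨q, hq, rfl⟩ := hq
        rw [a3 p hp, a3 q hq, hτ1, hτ1]
        simp only [lam_smul_left, lam_smul_right, hl, hα.2.1]
      · obtain ⟨p, hp, rfl⟩ := hp
        rw [a3 p hp, a2 q hq, hτ1]
        simp only [lam_smul_left]
        rw [hl0 _ (hps.1 _ (hb p hp)).1 q hq, hl0 _ (hb p hp) q hq]
      · obtain ⟨q, hq, rfl⟩ := hq
        rw [a3 q hq, a2 p hp, hτ1]
        simp only [lam_smul_right]
        rw [lam_neg, hl0 _ (hps.1 _ (hb q hq)).1 p hp, lam_neg, hl0 _ (hb q hq) p hp]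
      · rw [a2 p hp, a2 q hq]
    · intro p
      by_cases hp : p ∈ k '' block m
      · obtain ⟨p, hp, rfl⟩ := hp
        rw [a3 p hp, halfForm_smul_left, halfForm_smul_right, hh, ← mul_assoc]
        apply Γ.conj_mem'
        have := (mk_eq_iff Γ _ _).1 (hα.2.2 (Finsupp.single p 1))
        rw [halfForm_single_self, sub_zero] at this
        exact neg_mem this
      · rw [a2 p hp, halfForm_single_self]; exact zero_mem _
  have hα'S : α' ∈ SU T Γ := ⟨hα', hiso⟩
  refine ⟨α', a4, ?_, ?_⟩
  · intro p hp
    by_cases hpk : p ∈ k '' block m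
    · obtain ⟨p, hp', rfl⟩ := hpk
      rw [a3 p hp']
      exact Submodule.smul_mem _ _ (hτc _)
    · rw [a2 p hpk]
      exact Finsupp.single_mem_supported A 1 hp
  obtain ⟨θ, hθ, t1, t2⟩ := exists_diag T Γ m m le_rfl
  let K : Hyp A →ₗ[A] (ℕ →₀ A) := Finsupp.lsum ℕ fun p =>
    LinearMap.toSpanSingleton A _ (Finsupp.single (Sum.elim id (· + m) p) 1)
  have hK : ∀ p a, K (Finsupp.single p a) =
      Finsupp.single (Sum.elim id (· + m) p) (a * (fun _ => 1 : ℕ ⊕ ℕ → A) p) := by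
    intro p a
    simp [K]
  have hkK : Set.InjOn (Sum.elim id (· + m) : ℕ ⊕ ℕ → ℕ) (block m) := by
    rintro (i | i) (hi : i < m) (j | j) (hj : j < m) <;> simp <;> omega
  obtain ⟨β, hβ, b1, b2⟩ := transport _ hkK (fun _ => 1) (fun _ => Or.inl rfl) K hK hαm
  have hD : ∀ x ∈ Finsupp.supported A A (block m), θ (lagr (K x)) = x + τ x := by
    intro x hx
    refine supported_ind (P := fun x => θ (lagr (K x)) = x + τ x) (by simp)
      (fun x y hx hy => by simp only [map_add, hx, hy]; abel) ?_ hx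
    rintro (i | i) (hi : i < m) a
    · rw [hK, lagr_single, hτ, hkl, hsl, map_single]
      change (a * 1) • θ (e i) = _
      rw [(t1 i hi).1, mul_one, smul_add, hsg _ a, hsg _ a]; rfl
    · rw [hK, lagr_single, hτ, hkr, hsr, map_single]
      change (a * 1) • θ (e (i + m)) = _
      rw [(t1 i hi).2, mul_one, smul_sub, hsg _ a, hsg _ (a * -1), mul_neg, mul_one, neg_smul,
        sub_eq_add_neg]
      rfl
  have hγ : ∀ x ∈ Finsupp.supported A A (block m),
      (α * α') (θ (lagr (K x))) = θ (lagr (β (K x))) := by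
    intro x hx
    change α (α' _) = _
    rw [b1 x hx, hD x hx, hD _ (hps.1 x hx).1, map_add, map_add, a4 x hx, a1 x hx,
      hps.2 _ (hτc _)]
  have hγ' : ∀ x, (α * α') (θ (lagr x)) = θ (lagr (β x)) := by
    intro x
    induction x using Finsupp.induction_linear with
    | zero => simp
    | add x y hx hy => simp only [map_add, hx, hy]
    | single j a =>
      by_cases h1 : j < m
      · have := hγ _ (Finsupp.single_mem_supported A a (show Sum.inl j ∈ block m from h1))
        rw [hK] at this
        simpa using this
      by_cases h2 : m ≤ j ∧ j < m + m
      · have := hγ _ (Finsupp.single_mem_supported A a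
          (show Sum.inr (j - m) ∈ block m from show j - m < m by omega))
        rw [hK] at this
        simpa [Nat.sub_add_cancel h2.1] using this
      have h3 : j ∉ (Sum.elim id (· + m) : ℕ ⊕ ℕ → ℕ) '' block m := by
        rintro ⟨i | i, (hi : i < m), rfl⟩ <;> simp at h1 h2 <;> omega
      have h4 : Sum.inl j ∉ k '' block m := by
        rintro ⟨i | i, (hi : i < m), H⟩
        · rw [hkl] at H
          simp at H
          omega
        · rw [hkr] at H
          simp at H
      have h5 : θ (lagr (Finsupp.single j a)) = Finsupp.single (Sum.inl j) a := by
        rw [lagr_single, map_single, hsg _ a]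
        congr 1
        exact (t2 j h1 h2).1
      rw [map_single β, b2 j h3, Finsupp.smul_single, smul_eq_mul, mul_one, h5]
      change α (α' _) = _
      rw [map_single α', a2 _ h4, ← hsg]
      exact hps.2 _ (Finsupp.single_mem_supported A a h1)
  have hθS := RU_le_SU T Γ hθ
  have hmem : θ⁻¹ * (α * α') * θ ∈ RU T Γ := by
    refine Subgroup.subset_closure (Or.inl ⟨mul_mem (mul_mem (inv_mem hθS)
      (mul_mem hα hα'S)) hθS, β, hβ, fun x => ?_⟩)
    exact aut_inv_eq (hγ' x).symm
  have := mul_mem (mul_mem hθ hmem) (inv_mem hθ)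
  simpa [mul_assoc] using this

theorem RU_conj_mem {T : Subgroup Aˣ} {Γ : FormParameter A} {α ρ : Aut A (ℕ ⊕ ℕ)}
    (hα : α ∈ SU T Γ) (hρ : ρ ∈ RU T Γ) : α * ρ * α⁻¹ ∈ RU T Γ := by
  obtain ⟨m, hm⟩ := exists_simpleOn block block_mono exists_mem_block hα.1
  obtain ⟨n, hn⟩ := exists_simpleOn block block_mono exists_mem_block (RU_le_SU T Γ hρ).1
  have hm' := simpleOn_mono T (block_mono (le_max_left m n)) hm
  have hn' := simpleOn_props (simpleOn_mono T (block_mono (le_max_right m n)) hn)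
  obtain ⟨α', h1, h2, h3⟩ := exists_double hα hm'
  have hcomm : α' * ρ = ρ * α' := by
    apply aut_ext
    intro p
    change α' (ρ _) = ρ (α' _)
    by_cases hp : p ∈ block (max m n)
    · have hb := Finsupp.single_mem_supported A (1 : A) hp
      rw [h1 _ (hn'.1 _ hb).1, h1 _ hb]
    · rw [hn'.2 _ (Finsupp.single_mem_supported A (1 : A) hp), hn'.2 _ (h2 p hp)]
  have h4 := mul_mem (mul_mem h3 hρ) (inv_mem h3)
  have h5 : α * α' * ρ * (α * α')⁻¹ = α * ρ * α⁻¹ := by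
    rw [mul_assoc α, hcomm]
    group
  rwa [h5] at h4

instance RU_normal (T : Subgroup Aˣ) (Γ : FormParameter A) :
    ((RU T Γ).subgroupOf (SU T Γ)).Normal where
  conj_mem _ hρ α := RU_conj_mem α.2 hρ

/-- The odd-dimensional L-group `SU(A) / RU(A)` (sign `ε = -1`, simple torsion) of the ring with involution `A` with form parameter `Γ` and
group of trivial units `T`. -/
def L3 (T : Subgroup Aˣ) (Γ : FormParameter A) : Type _ :=
  SU T Γ ⧸ (RU T Γ).subgroupOf (SU T Γ)

instance (T : Subgroup Aˣ) (Γ : FormParameter A) : Group (L3 T Γ) :=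
  inferInstanceAs (Group (SU T Γ ⧸ (RU T Γ).subgroupOf (SU T Γ)))

theorem SU_mono (T : Subgroup Aˣ) {Γ Γ' : FormParameter A}
    (hΓ : Γ.toAddSubgroup ≤ Γ'.toAddSubgroup) : SU T Γ ≤ SU T Γ' :=
  fun _ hα => ⟨hα.1, hα.2.1, fun x => (mk_eq_iff _ _ _).2 (hΓ ((mk_eq_iff _ _ _).1 (hα.2.2 x)))⟩

theorem RU_mono (T : Subgroup Aˣ) {Γ Γ' : FormParameter A}
    (hΓ : Γ.toAddSubgroup ≤ Γ'.toAddSubgroup) : RU T Γ ≤ RU T Γ' := by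
  apply Subgroup.closure_mono
  rintro α (⟨h1, h2⟩ | h)
  · exact Or.inl ⟨SU_mono T hΓ h1, h2⟩
  · exact Or.inr h

/-- The natural map between L-groups induced by an inclusion of form parameters: the class of an
isometry `α` is sent to the class of `α`. -/
def L3.map (T : Subgroup Aˣ) {Γ Γ' : FormParameter A}
    (hΓ : Γ.toAddSubgroup ≤ Γ'.toAddSubgroup) : L3 T Γ →* L3 T Γ' :=
  QuotientGroup.map _ _ (Subgroup.inclusion (SU_mono T hΓ)) fun _ hα => RU_mono T hΓ hα

end LGroup

/-! ### Integral group rings -/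

section GroupRing

variable (π : Type*) [Group π]

/-- The involution `∑ n_g g ↦ ∑ n_g g⁻¹` on the integral group ring. -/
instance : StarRing (MonoidAlgebra ℤ π) where
  star a := MonoidAlgebra.mapDomain (·⁻¹) a
  star_involutive a := by
    induction a using MonoidAlgebra.induction_linear with
    | zero => simp
    | add x y hx hy => simp only [MonoidAlgebra.mapDomain_add, hx, hy]
    | single g n => simp
  star_mul a b := by
    induction a using MonoidAlgebra.induction_linear with
    | zero => simp
    | add x y hx hy => simp only [add_mul, mul_add, MonoidAlgebra.mapDomain_add, hx, hy]
    | single g n =>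
      induction b using MonoidAlgebra.induction_linear with
      | zero => simp
      | add x y hx hy => simp only [add_mul, mul_add, MonoidAlgebra.mapDomain_add, hx, hy]
      | single g' n' => simp [MonoidAlgebra.single_mul_single, mul_comm]
  star_add a b := MonoidAlgebra.mapDomain_add _ a b

/-- The trivial units `±g` of the integral group ring. -/
def trivialUnits : Subgroup (MonoidAlgebra ℤ π)ˣ where
  carrier := {u | ∃ g : π, (u : MonoidAlgebra ℤ π) = MonoidAlgebra.of ℤ π g ∨
    (u : MonoidAlgebra ℤ π) = -MonoidAlgebra.of ℤ π g}
  one_mem' := ⟨1, Or.inl (by rw [map_one, Units.val_one])⟩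
  mul_mem' := by
    rintro u v ⟨g, hg⟩ ⟨k, hk⟩
    refine ⟨g * k, ?_⟩
    rcases hg with hg | hg <;> rcases hk with hk | hk <;> simp only [Units.val_mul, hg, hk, map_mul]
    · left; trivial
    · right; simp
    · right; simp
    · left; simp
  inv_mem' := by
    rintro u ⟨g, hg⟩
    refine ⟨g⁻¹, ?_⟩
    have h1 : MonoidAlgebra.of ℤ π g * MonoidAlgebra.of ℤ π g⁻¹ = 1 := by
      rw [← map_mul, mul_inv_cancel, map_one]
    rcases hg with hg | hg
    · left
      rw [Units.inv_eq_of_mul_eq_one_right (a := MonoidAlgebra.of ℤ π g⁻¹)]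
      rw [hg, h1]
    · right
      rw [Units.inv_eq_of_mul_eq_one_right (a := -MonoidAlgebra.of ℤ π g⁻¹)]
      rw [hg, neg_mul_neg, h1]

/-- The minimal form parameter `{a + ā | a ∈ ℤ[π]}`. -/
def minParameter : FormParameter (MonoidAlgebra ℤ π) where
  carrier := {c | ∃ a, c = a + star a}
  zero_mem' := ⟨0, by simp⟩
  add_mem' := by
    rintro _ _ ⟨a, rfl⟩ ⟨b, rfl⟩
    exact ⟨a + b, by rw [star_add]; abel⟩
  neg_mem' := by
    rintro _ ⟨a, rfl⟩
    exact ⟨-a, by rw [star_neg]; abel⟩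
  add_star_mem' a := ⟨a, rfl⟩
  star_eq' := by
    rintro _ ⟨a, rfl⟩
    rw [star_add, star_star, add_comm]
  conj_mem' := by
    rintro a _ ⟨b, rfl⟩
    exact ⟨a * b * star a, by simp [mul_add, add_mul, mul_assoc]⟩

theorem exists_conj (a : MonoidAlgebra ℤ π) :
    ∃ (n : ℤ) (b : MonoidAlgebra ℤ π), a * star a = n • 1 + (b + star b) := by
  induction a using MonoidAlgebra.induction_linear with
  | zero => exact ⟨0, 0, by simp⟩
  | add x y hx hy =>
    obtain ⟨n, b, hb⟩ := hx
    obtain ⟨m, c, hc⟩ := hy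
    refine ⟨n + m, b + c + x * star y, ?_⟩
    rw [star_add, add_mul, mul_add, mul_add, hb, hc, add_smul]
    simp only [star_add, star_mul, star_star]
    abel
  | single g n =>
    refine ⟨n * n, 0, ?_⟩
    change MonoidAlgebra.single g n * MonoidAlgebra.mapDomain (·⁻¹) (MonoidAlgebra.single g n) = _
    rw [MonoidAlgebra.mapDomain_single, MonoidAlgebra.single_mul_single, mul_inv_cancel,
      MonoidAlgebra.one_def]
    simp

/-- The form parameter generated by `1` and all `a + ā`, for `a ∈ ℤ[π]`. -/
def tildeParameter : FormParameter (MonoidAlgebra ℤ π) where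
  carrier := {c | ∃ (n : ℤ) (a : MonoidAlgebra ℤ π), c = n • 1 + (a + star a)}
  zero_mem' := ⟨0, 0, by simp⟩
  add_mem' := by
    rintro _ _ ⟨n, a, rfl⟩ ⟨m, b, rfl⟩
    exact ⟨n + m, a + b, by rw [star_add, add_smul]; abel⟩
  neg_mem' := by
    rintro _ ⟨n, a, rfl⟩
    exact ⟨-n, -a, by rw [star_neg, neg_smul]; abel⟩
  add_star_mem' a := ⟨0, a, by simp⟩
  star_eq' := by
    rintro _ ⟨n, a, rfl⟩
    rw [star_add, star_add, star_star, star_zsmul, star_one, add_comm a]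
  conj_mem' := by
    rintro a _ ⟨n, b, rfl⟩
    obtain ⟨m, c, hc⟩ := exists_conj π a
    refine ⟨n * m, n • c + a * b * star a, ?_⟩
    have : a * (n • 1 + (b + star b)) * star a =
        n • (a * star a) + a * (b + star b) * star a := by
      rw [mul_add, add_mul, mul_smul_comm, mul_one, smul_mul_assoc]
    rw [this, hc]
    simp only [smul_add, smul_smul, star_add, star_zsmul, star_mul, star_star, mul_add, add_mul,
      mul_assoc]
    abel

theorem minParameter_le :
    (minParameter π).toAddSubgroup ≤ (tildeParameter π).toAddSubgroup := by
  rintro _ ⟨a, rfl⟩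
  exact ⟨0, a, by simp⟩

/-- The ordinary L-group `L₃ˢ(π)`. -/
abbrev Ls3 : Type _ := L3 (trivialUnits π) (minParameter π)

/-- The tilde L-group, with the larger form parameter. -/
abbrev LsTilde3 : Type _ := L3 (trivialUnits π) (tildeParameter π)

/-- The natural map from the ordinary L-group to the tilde L-group. -/
def natMap : Ls3 π →* LsTilde3 π := L3.map (trivialUnits π) (minParameter_le π)

end GroupRing

end OddL

end

/-! Let `ε` be the augmentation mod 2 and `q(x) = ε(h(x, x))` the induced quadratic form with values
in `𝔽₂`. An element `n + a + ā` of the large parameter lies in the minimal one as soon as `ε` kills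
it, so an isometry `α` for the large parameter is one for the minimal parameter once `q ∘ α - q`
vanishes on the basis. Surjectivity therefore amounts to killing this defect by right multiplication
with elements of `RU` for the large parameter.

Since `α` preserves `λ`, whose reduction is the polarization of `q`, the defect is a linear form `ℓ`
over `𝔽₂` (`defect_add`, `defect_smul`). On finitely many planes the reduction of `α` is a bijection
carrying `q + ℓ` to `q`, so the two forms have equal Gauss sums, which is invariance of the Arf
invariant. Hence `∑ ℓ(e_i) ℓ(f_i) = 0` (`sum_defect_eq_zero`): the number of planes with `ℓ(e_i) =
ℓ(f_i) = 1` is even.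

A plane on which `ℓ(e_i) ℓ(f_i) = 0` is cleared by a flip, if needed, and the transvection `f_i ↦
f_i + e_i`, which is available because `1` lies in the large parameter (`exists_clear`). If every
remaining plane has both values `1`, there are at least two of them, and `e_i ↦ e_i + e_j`, `f_j ↦
f_j - f_i` makes `ℓ(e_i)` vanish (`exists_merge`). Induction on the set of remaining planes finishes
the argument (`exists_defect_eq_zero`). -/

namespace OddL

/-! ### Gauss sums and the Arf invariant over `𝔽₂` -/

section Arf

/-- The nontrivial character of `ZMod 2`. -/
def signChar (t : ZMod 2) : ℤ := if t = 0 then 1 else -1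

theorem signChar_sum {ι : Type*} (s : Finset ι) (g : ι → ZMod 2) :
    signChar (∑ i ∈ s, g i) = ∏ i ∈ s, signChar (g i) := by
  classical
  have hadd : ∀ a b, signChar (a + b) = signChar a * signChar b := by decide
  induction s using Finset.induction_on with
  | empty => rfl
  | insert i s hi ih => rw [Finset.sum_insert hi, Finset.prod_insert hi, hadd, ih]

/-- The sum factors over the planes. In one plane `xy + xa + yb = (x + b)(y + a) + ab` in
characteristic 2, so a translation reduces to the sum of `(-1)^(xy)`, which is 2. -/
theorem gauss_sum {ι : Type*} [Fintype ι] [DecidableEq ι] (a b : ι → ZMod 2) :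
    ∑ v : ι → ZMod 2 × ZMod 2,
      signChar (∑ i, ((v i).1 * (v i).2 + (v i).1 * a i + (v i).2 * b i)) =
      2 ^ Fintype.card ι * signChar (∑ i, a i * b i) := by
  have hplane : ∀ a b : ZMod 2, ∑ p : ZMod 2 × ZMod 2,
      signChar (p.1 * p.2 + p.1 * a + p.2 * b) = 2 * signChar (a * b) := by decide
  simp only [signChar_sum]
  rw [← Fintype.piFinset_univ, ← Finset.prod_univ_sum (fun _ => Finset.univ)
    (fun i (p : ZMod 2 × ZMod 2) => signChar (p.1 * p.2 + p.1 * a i + p.2 * b i))]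
  simp only [hplane, Finset.prod_mul_distrib, Finset.prod_const, Finset.card_univ]

/-- Invariance of the Arf invariant: if the hyperbolic quadratic form over `𝔽₂` is equivalent to
its sum with the linear form with coefficients `a` and `b`, then `∑ aᵢ bᵢ = 0`. -/
theorem arf_eq_zero {ι : Type*} [Fintype ι] [DecidableEq ι] (a b : ι → ZMod 2)
    (T : (ι → ZMod 2 × ZMod 2) → ι → ZMod 2 × ZMod 2) (hT : Function.Bijective T)
    (h : ∀ v, ∑ i, (T v i).1 * (T v i).2 =
      ∑ i, ((v i).1 * (v i).2 + (v i).1 * a i + (v i).2 * b i)) :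
    ∑ i, a i * b i = 0 := by
  have h1 := gauss_sum a b
  have h2 := gauss_sum (fun _ : ι => 0) (fun _ => 0)
  simp only [mul_zero, add_zero, Finset.sum_const_zero] at h2
  simp only [← h] at h1
  -- Reindexing along `T` identifies the two Gauss sums, hence the signs of `∑ aᵢ bᵢ` and of 0. Only
  -- bijectivity of `T` enters, not linearity.
  rw [hT.sum_comp (fun v => signChar (∑ i, (v i).1 * (v i).2)), h2] at h1
  have h3 := mul_left_cancel₀ (pow_ne_zero _ two_ne_zero) h1
  generalize ∑ i, a i * b i = t at h3
  revert h3
  revert t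
  decide

end Arf

/-! ### Reduction of vectors to `𝔽₂` and lifting back -/

section Coordinates

variable {A : Type*} [Ring A]

/-- The coordinates in `𝔽₂` of a vector with respect to the first `m` hyperbolic planes. -/
noncomputable def redCoord (ε : A →+* ZMod 2) (m : ℕ) (x : Hyp A) (i : Fin m) : ZMod 2 × ZMod 2 :=
  (ε (x (Sum.inl i)), ε (x (Sum.inr i)))

theorem redCoord_sub (ε : A →+* ZMod 2) (m : ℕ) (x y : Hyp A) :
    redCoord ε m (x - y) = redCoord ε m x - redCoord ε m y := by
  funext i
  simp [redCoord]

/-- By linearity each coordinate of `β z` is a left combination of the coordinates of `z`, and `ε`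
is multiplicative. The support condition is needed because `redCoord` does not see coordinates
outside the block. -/
theorem redCoord_apply_eq_zero (ε : A →+* ZMod 2) {m : ℕ} {z : Hyp A}
    (hz : z ∈ Finsupp.supported A A (block m)) (h : redCoord ε m z = 0) (β : Aut A (ℕ ⊕ ℕ)) :
    redCoord ε m (β z) = 0 := by
  have h1 : ∀ p ∈ block m, ε (z p) = 0 := by
    rintro (i | i) (hi : i < m)
    · exact congrArg Prod.fst (congrFun h ⟨i, hi⟩)
    · exact congrArg Prod.snd (congrFun h ⟨i, hi⟩)
  have h2 : ∀ q, ε (β z q) = 0 := by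
    intro q
    rw [← Finsupp.sum_single z, map_finsuppSum, Finsupp.sum_apply, map_finsuppSum]
    apply Finset.sum_eq_zero
    intro p hp
    change ε ((β (Finsupp.single p (z p))) q) = 0
    rw [map_single, Finsupp.smul_apply, smul_eq_mul, map_mul, h1 p (hz hp), zero_mul]
  funext i
  exact Prod.ext (h2 _) (h2 _)

/-- This lets an automorphism act on coordinates over `𝔽₂` through arbitrary lifts, with no base
change of the module. -/
theorem redCoord_apply_congr (ε : A →+* ZMod 2) {m : ℕ} {x y : Hyp A}
    (hx : x ∈ Finsupp.supported A A (block m)) (hy : y ∈ Finsupp.supported A A (block m))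
    (h : redCoord ε m x = redCoord ε m y) (β : Aut A (ℕ ⊕ ℕ)) :
    redCoord ε m (β x) = redCoord ε m (β y) := by
  have := redCoord_apply_eq_zero ε (sub_mem hx hy) (by rw [redCoord_sub, h, sub_self]) β
  rw [map_sub, redCoord_sub] at this
  exact sub_eq_zero.1 this

/-- A lift of a vector over `𝔽₂` to the first `m` hyperbolic planes over `A`. -/
noncomputable def liftCoord (A : Type*) [Ring A] {m : ℕ} (v : Fin m → ZMod 2 × ZMod 2) : Hyp A :=
  ∑ i, (((v i).1.val : A) • e (i : ℕ) + ((v i).2.val : A) • f (i : ℕ))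

theorem liftCoord_mem {m : ℕ} (v : Fin m → ZMod 2 × ZMod 2) :
    liftCoord A v ∈ Finsupp.supported A A (block m) :=
  Submodule.sum_mem _ fun i _ => add_mem
    (Submodule.smul_mem _ _ (Finsupp.single_mem_supported A 1 (show (i : ℕ) < m from i.2)))
    (Submodule.smul_mem _ _ (Finsupp.single_mem_supported A 1 (show (i : ℕ) < m from i.2)))

theorem redCoord_liftCoord (ε : A →+* ZMod 2) {m : ℕ} (v : Fin m → ZMod 2 × ZMod 2) :
    redCoord ε m (liftCoord A v) = v := by
  funext i
  apply Prod.ext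
  · simp [redCoord, liftCoord, e, f, Finsupp.finsetSum_apply, Finsupp.single_apply, Fin.val_inj]
  · simp [redCoord, liftCoord, e, f, Finsupp.finsetSum_apply, Finsupp.single_apply, Fin.val_inj]

end Coordinates

/-! ### The reduced quadratic form and the defect of an isometry -/

section Reduction

variable {A : Type*} [Ring A] [StarRing A]

/-- The reduction of the quadratic form `h(x, x)` along a ring homomorphism to `𝔽₂`. -/
noncomputable def redQuad (ε : A →+* ZMod 2) (x : Hyp A) : ZMod 2 := ε (halfForm x x)

theorem redQuad_single (ε : A →+* ZMod 2) (p : ℕ ⊕ ℕ) (a : A) :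
    redQuad ε (Finsupp.single p a) = 0 := by
  rw [redQuad, halfForm_single_self, map_zero]

/-- Signs disappear mod 2 and `ε` ignores the involution, so `λ` reduces to the polarization of the
reduced form. -/
theorem redQuad_add {ε : A →+* ZMod 2} (hε : ∀ a, ε (star a) = ε a) (x y : Hyp A) :
    redQuad ε (x + y) = redQuad ε x + redQuad ε y + ε (lam x y) := by
  simp only [redQuad, lam, halfForm_add_left, halfForm_add_right, map_add, map_sub, hε,
    CharTwo.sub_eq_add]
  abel

/-- The scalar would enter as `ε(a)²`, which equals `ε(a)` in `𝔽₂`. This is why the defect is linear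
rather than only quadratic in scalars. -/
theorem redQuad_smul {ε : A →+* ZMod 2} (hε : ∀ a, ε (star a) = ε a) (a : A) (x : Hyp A) :
    redQuad ε (a • x) = ε a * redQuad ε x := by
  have : ∀ s t : ZMod 2, s * (t * s) = s * t := by decide
  rw [redQuad, halfForm_smul_left, halfForm_smul_right, map_mul, map_mul, hε, this, redQuad]

/-- The failure of `α` to preserve the reduced quadratic form. -/
noncomputable def defect (ε : A →+* ZMod 2) (α : Aut A (ℕ ⊕ ℕ)) (x : Hyp A) : ZMod 2 :=
  redQuad ε (α x) - redQuad ε x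

/-- The polarization terms of `q ∘ α` and `q` cancel because `α` preserves `λ`. -/
theorem defect_add {ε : A →+* ZMod 2} (hε : ∀ a, ε (star a) = ε a) {Γ : FormParameter A}
    {α : Aut A (ℕ ⊕ ℕ)} (hα : IsIsometry Γ α) (x y : Hyp A) :
    defect ε α (x + y) = defect ε α x + defect ε α y := by
  simp only [defect, map_add, redQuad_add hε, hα.1]
  abel

theorem defect_smul {ε : A →+* ZMod 2} (hε : ∀ a, ε (star a) = ε a) (α : Aut A (ℕ ⊕ ℕ)) (a : A)
    (x : Hyp A) : defect ε α (a • x) = ε a * defect ε α x := by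
  simp only [defect, map_smul, redQuad_smul hε, mul_sub]

theorem defect_neg {ε : A →+* ZMod 2} (hε : ∀ a, ε (star a) = ε a) (α : Aut A (ℕ ⊕ ℕ))
    (x : Hyp A) : defect ε α (-x) = defect ε α x := by
  rw [← neg_one_smul A, defect_smul hε, map_neg, map_one, CharTwo.neg_eq, one_mul]

/-- Cocycle rule governing all later moves: it gives the effect on the defect of right
multiplication by `β`. -/
theorem defect_mul (ε : A →+* ZMod 2) (α β : Aut A (ℕ ⊕ ℕ)) (x : Hyp A) :
    defect ε (α * β) x = defect ε α (β x) + defect ε β x := by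
  change redQuad ε (α (β x)) - redQuad ε x = _
  simp only [defect]
  abel

theorem defect_of_fixed (ε : A →+* ZMod 2) {α : Aut A (ℕ ⊕ ℕ)} {x : Hyp A} (h : α x = x) :
    defect ε α x = 0 := by
  rw [defect, h, sub_self]

theorem halfForm_eq_sum {m : ℕ} {x : Hyp A} (hx : x ∈ Finsupp.supported A A (block m))
    (y : Hyp A) :
    halfForm x y = ∑ i : Fin m, x (Sum.inl i) * star (y (Sum.inr i)) := by
  refine supported_ind
    (P := fun x => halfForm x y = ∑ i : Fin m, x (Sum.inl i) * star (y (Sum.inr i)))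
    ?_ ?_ ?_ hx
  · simp [halfForm_zero_left]
  · intro x x' h h'
    simp only [halfForm_add_left, h, h', Finsupp.add_apply, add_mul, Finset.sum_add_distrib]
  · rintro (i | i) hi a
    · have hi : i < m := hi
      rw [Finset.sum_eq_single ⟨i, hi⟩]
      · simp [halfForm]
      · intro j _ hj
        have : (j : ℕ) ≠ i := fun H => hj (Fin.ext H)
        simp [this]
      · simp
    · simp [halfForm]

theorem redQuad_eq_sum {ε : A →+* ZMod 2} (hε : ∀ a, ε (star a) = ε a) {m : ℕ} {x : Hyp A}
    (hx : x ∈ Finsupp.supported A A (block m)) :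
    redQuad ε x = ∑ i, (redCoord ε m x i).1 * (redCoord ε m x i).2 := by
  simp [redQuad, halfForm_eq_sum hx, hε, redCoord]

theorem defect_liftCoord {ε : A →+* ZMod 2} (hε : ∀ a, ε (star a) = ε a) {Γ : FormParameter A}
    {α : Aut A (ℕ ⊕ ℕ)} (hα : IsIsometry Γ α) {m : ℕ} (v : Fin m → ZMod 2 × ZMod 2) :
    defect ε α (liftCoord A v) =
      ∑ i : Fin m, ((v i).1 * defect ε α (e (i : ℕ)) + (v i).2 * defect ε α (f (i : ℕ))) := by
  have h0 : defect ε α 0 = 0 := defect_of_fixed ε (map_zero α)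
  let D : Hyp A →+ ZMod 2 := ⟨⟨defect ε α, h0⟩, defect_add hε hα⟩
  change D _ = _
  rw [liftCoord, map_sum]
  refine Finset.sum_congr rfl fun i _ => ?_
  change defect ε α _ = _
  rw [defect_add hε hα, defect_smul hε, defect_smul hε]
  -- `ε` sends the cast of the representative of a residue back to that residue.
  simp

/-- The linear form by which an isometry fails to preserve the reduced quadratic form has trivial
Arf invariant. -/
theorem sum_defect_eq_zero {ε : A →+* ZMod 2} (hε : ∀ a, ε (star a) = ε a) {T : Subgroup Aˣ}
    {Γ : FormParameter A} {α : Aut A (ℕ ⊕ ℕ)} (hα : α ∈ SU T Γ) {m : ℕ}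
    (hm : α ∈ simpleOn T (block m)) :
    ∑ i ∈ Finset.range m, defect ε α (e i) * defect ε α (f i) = 0 := by
  have hps := (simpleOn_props hm).1
  rw [Finset.sum_range]
  refine arf_eq_zero _ _ (fun v => redCoord ε m (α (liftCoord A v))) ?_ fun v => ?_
  · apply Function.Injective.bijective_of_finite
    apply Function.LeftInverse.injective (g := fun v => redCoord ε m (α⁻¹ (liftCoord A v)))
    intro v
    have h1 := (hps _ (liftCoord_mem v)).1
    change redCoord ε m (α⁻¹ (liftCoord A (redCoord ε m (α (liftCoord A v))))) = v
    rw [redCoord_apply_congr ε (liftCoord_mem _) h1 (redCoord_liftCoord ε _), aut_inv_eq rfl,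
      redCoord_liftCoord]
  · have h1 := redQuad_eq_sum hε (hps _ (liftCoord_mem v)).1
    have h2 := redQuad_eq_sum hε (liftCoord_mem (A := A) v)
    have h3 := defect_liftCoord hε hα.2 v
    rw [redCoord_liftCoord] at h2
    rw [← h1, ← sub_add_cancel (redQuad ε (α (liftCoord A v))) (redQuad ε (liftCoord A v)),
      ← defect, h2, h3, ← Finset.sum_add_distrib]
    exact Finset.sum_congr rfl fun i _ => by ring

theorem sum_defect_finset_eq_zero {ε : A →+* ZMod 2} (hε : ∀ a, ε (star a) = ε a)
    {T : Subgroup Aˣ} {Γ : FormParameter A} {α : Aut A (ℕ ⊕ ℕ)} (hα : α ∈ SU T Γ) (s : Finset ℕ)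
    (hs : ∀ i, i ∉ s → defect ε α (e i) = 0) :
    ∑ i ∈ s, defect ε α (e i) * defect ε α (f i) = 0 := by
  obtain ⟨n, hn⟩ := exists_simpleOn block block_mono exists_mem_block hα.1
  -- The block must contain both the support of `α` and all of `s`. The `+ 1` is there because
  -- `range` omits its bound.
  have hm := simpleOn_mono T (block_mono (le_max_left n (s.sup id + 1))) hn
  rw [← sum_defect_eq_zero hε hα hm]
  apply Finset.sum_subset
  · intro i hi
    have : i ≤ s.sup id := Finset.le_sup (f := id) hi
    exact Finset.mem_range.2 (by omega)
  · intro i _ hi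
    rw [hs i hi, zero_mul]

/-- An isometry for the larger form parameter whose defect vanishes is an isometry for the smaller
one. -/
theorem mem_SU_of_defect {ε : A →+* ZMod 2} {T : Subgroup Aˣ} {Γ Γ' : FormParameter A}
    (hΓ : ∀ c ∈ Γ'.toAddSubgroup, ε c = 0 → c ∈ Γ.toAddSubgroup) {α : Aut A (ℕ ⊕ ℕ)}
    (hα : α ∈ SU T Γ') (he : ∀ i, defect ε α (e i) = 0) (hf : ∀ i, defect ε α (f i) = 0) :
    α ∈ SU T Γ := by
  -- The form `h(b, b)` vanishes on each basis vector `b`, so the defect at `b` is `ε(h(α b, α b))`,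
  -- with argument in `Γ'`. Its vanishing puts that argument in `Γ`.
  refine ⟨hα.1, isIsometry_of_basis Γ α (fun p q => hα.2.1 _ _) fun p => hΓ _ ?_ ?_⟩
  · have := (mk_eq_iff Γ' _ _).1 (hα.2.2 (Finsupp.single p 1))
    rwa [halfForm_single_self, sub_zero] at this
  · have h : defect ε α (Finsupp.single p 1) = 0 := by
      rcases p with i | i
      · exact he i
      · exact hf i
    rwa [defect, redQuad_single, sub_zero] at h

end Reduction

/-! ### Killing the defect by elements of `RU` -/

section Moves

variable {A : Type*} [Ring A] [StarRing A]

/-- If `1 ∈ Γ`, the transvection `f_i ↦ f_i + e_i` lies in `RU(A)`. -/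
theorem exists_transvection (T : Subgroup Aˣ) {Γ : FormParameter A}
    (h1 : (1 : A) ∈ Γ.toAddSubgroup) (i : ℕ) :
    ∃ τ ∈ RU T Γ, τ (f i) = f i + e i ∧ (∀ k, τ (e k) = e k) ∧
      ∀ k, k ≠ i → τ (f k) = f k := by
  obtain ⟨τ, hτ⟩ := exists_isElementary (A := A)
    (show (Sum.inr i : ℕ ⊕ ℕ) ≠ Sum.inl i by simp) 1
  have hS := elementary_mem T hτ
  obtain ⟨-, t1, t2⟩ := hτ
  have hl : ∀ k, τ (Finsupp.single (Sum.inl k) 1) = Finsupp.single (Sum.inl k) 1 :=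
    fun k => t2 _ (by simp)
  have hr : ∀ k, k ≠ i → τ (Finsupp.single (Sum.inr k) 1) = Finsupp.single (Sum.inr k) 1 :=
    fun k hk => t2 _ (by simpa using hk)
  -- All `e_k` are fixed, so the Lagrangian is preserved by the identity.
  refine ⟨τ, Subgroup.subset_closure (Or.inl ⟨⟨hS, isIsometry_of_basis Γ τ ?_ ?_⟩,
    1, one_mem _, ?_⟩), t1, hl, hr⟩
  · rintro (j | j) (k | k)
    · rw [hl, hl]
    · by_cases hk : k = i
      · subst hk
        rw [hl, t1, lam_add_right, lam_single (Sum.inl j) (Sum.inl k)]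
        simp
      · rw [hl, hr k hk]
    · by_cases hj : j = i
      · subst hj
        rw [hl, t1, lam_add_left, lam_single (Sum.inl j) (Sum.inl k)]
        simp
      · rw [hl, hr j hj]
    · by_cases hj : j = i <;> by_cases hk : k = i
      · subst hj; subst hk
        -- Here `λ(f + e, f + e) = λ(f, e) + λ(e, f) = -1 + 1 = 0`.
        simp [t1, lam_add_left, lam_add_right, lam_single]
      · subst hj
        simp [t1, hr k hk, lam_add_left, lam_single, hk]
      · subst hk
        simp [t1, hr j hj, lam_add_right, lam_single, Ne.symm hj]
      · rw [hr j hj, hr k hk]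
  · rintro (j | j)
    · rw [hl, halfForm_single_self]; exact zero_mem _
    · by_cases hj : j = i
      · subst hj
        -- The value of `h` on `f_j + e_j` is `h(e_j, f_j) = 1`; this is the one place where `1 ∈ Γ`
        -- is needed.
        simpa [t1, halfForm_add_left, halfForm_add_right, halfForm_single] using h1
      · rw [hr j hj, halfForm_single_self]; exact zero_mem _
  · intro x
    induction x using Finsupp.induction_linear with
    | zero => simp
    | add x y hx hy => rw [map_add, map_add, hx, hy]; simp
    | single j a =>
      change τ _ = lagr (Finsupp.single j a)
      rw [lagr_single, map_single, hl]
      simp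

variable {ε : A →+* ZMod 2} {T : Subgroup Aˣ} {Γ : FormParameter A}

theorem redQuad_e (ε : A →+* ZMod 2) (i : ℕ) : redQuad ε (e i) = 0 := redQuad_single ε _ _

theorem redQuad_f (ε : A →+* ZMod 2) (i : ℕ) : redQuad ε (f i) = 0 := redQuad_single ε _ _

theorem defect_eq_zero_or_one (ε : A →+* ZMod 2) (α : Aut A (ℕ ⊕ ℕ)) (x : Hyp A) :
    defect ε α x = 0 ∨ defect ε α x = 1 := by
  generalize defect ε α x = t
  revert t
  decide

/-- A transvection kills the defect on a plane in which only `f_i` has nontrivial defect. -/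
theorem exists_clear_of_e (hε : ∀ a, ε (star a) = ε a) (h1 : (1 : A) ∈ Γ.toAddSubgroup)
    {α : Aut A (ℕ ⊕ ℕ)} (hα : α ∈ SU T Γ) {i : ℕ} (hi : defect ε α (e i) = 0) :
    ∃ ρ ∈ RU T Γ, defect ε (α * ρ) (e i) = 0 ∧ defect ε (α * ρ) (f i) = 0 ∧
      ∀ k, k ≠ i → defect ε (α * ρ) (e k) = defect ε α (e k) ∧
        defect ε (α * ρ) (f k) = defect ε α (f k) := by
  rcases defect_eq_zero_or_one ε α (f i) with hf | hf
  · exact ⟨1, one_mem _, by rwa [mul_one], by rwa [mul_one], fun k _ => by simp⟩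
  obtain ⟨τ, hτ, t1, t2, t3⟩ := exists_transvection T h1 i
  refine ⟨τ, hτ, ?_, ?_, fun k hk => ⟨?_, ?_⟩⟩
  · rw [defect_mul, t2, hi, defect_of_fixed ε (t2 i), add_zero]
  · have h2 : defect ε τ (f i) = 1 := by
      rw [defect, t1, redQuad_add hε, redQuad_e, redQuad_f]
      simp [e, f, lam_single]
    rw [defect_mul, t1, defect_add hε hα.2, hi, hf, h2]
    decide
  · rw [defect_mul, t2, defect_of_fixed ε (t2 k), add_zero]
  · rw [defect_mul, t3 k hk, defect_of_fixed ε (t3 k hk), add_zero]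

/-- One of the two defects vanishes. If it is the one at `f_i`, the flip moves it to `e_i`. -/
theorem exists_clear (hε : ∀ a, ε (star a) = ε a) (h1 : (1 : A) ∈ Γ.toAddSubgroup)
    {α : Aut A (ℕ ⊕ ℕ)} (hα : α ∈ SU T Γ) {i : ℕ}
    (hi : defect ε α (e i) * defect ε α (f i) = 0) :
    ∃ ρ ∈ RU T Γ, defect ε (α * ρ) (e i) = 0 ∧ defect ε (α * ρ) (f i) = 0 ∧
      ∀ k, k ≠ i → defect ε (α * ρ) (e k) = defect ε α (e k) ∧
        defect ε (α * ρ) (f k) = defect ε α (f k) := by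
  rcases mul_eq_zero.1 hi with he | hf
  · exact exists_clear_of_e hε h1 hα he
  obtain ⟨σ, -, hσ⟩ := exists_isFlip T (A := A) i
  have hσR : σ ∈ RU T Γ := Subgroup.subset_closure (Or.inr ⟨i, hσ⟩)
  obtain ⟨s1, -, s3⟩ := hσ
  have h2 : defect ε (α * σ) (e i) = 0 := by
    rw [defect_mul, s1, hf, defect, s1, redQuad_e, redQuad_f]
    simp
  obtain ⟨ρ, hρ, r1, r2, r3⟩ := exists_clear_of_e hε h1 (mul_mem hα (RU_le_SU T Γ hσR)) h2
  rw [mul_assoc] at r1 r2 r3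
  refine ⟨σ * ρ, mul_mem hσR hρ, r1, r2, fun k hk => ⟨?_, ?_⟩⟩
  · rw [(r3 k hk).1, defect_mul, (s3 k hk).1, defect_of_fixed ε (s3 k hk).1, add_zero]
  · rw [(r3 k hk).2, defect_mul, (s3 k hk).2, defect_of_fixed ε (s3 k hk).2, add_zero]

/-- If `e_i` and `e_j` have nontrivial defect, then a hyperbolic map makes the defect of `e_i`
trivial, and changes the defect in these two planes only. -/
theorem exists_merge (hε : ∀ a, ε (star a) = ε a) {α : Aut A (ℕ ⊕ ℕ)} (hα : α ∈ SU T Γ)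
    {i j : ℕ} (hij : i ≠ j) (hi : defect ε α (e i) = 1) (hj : defect ε α (e j) = 1) :
    ∃ ρ ∈ RU T Γ, defect ε (α * ρ) (e i) = 0 ∧
      ∀ k, k ≠ i → k ≠ j → defect ε (α * ρ) (e k) = defect ε α (e k) ∧
        defect ε (α * ρ) (f k) = defect ε α (f k) := by
  obtain ⟨ρ, hρ, r1, -, r3, r4⟩ := exists_hyp T Γ hij
  refine ⟨ρ, hρ, ?_, fun k hk hk' => ⟨?_, ?_⟩⟩
  · have h2 : defect ε ρ (e i) = 0 := by
      rw [defect, r1, redQuad_add hε, redQuad_e, redQuad_e]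
      simp [e, lam_single]
    -- The defects of `α` at `e_i` and `e_j` add up to `1 + 1 = 0`, and `q(e_i + e_j) = 0` since
    -- `λ(e_i, e_j) = 0`.
    rw [defect_mul, r1, defect_add hε hα.2, hi, hj, h2]
    decide
  · rw [defect_mul, r3 k hk, defect_of_fixed ε (r3 k hk), add_zero]
  · rw [defect_mul, r4 k hk', defect_of_fixed ε (r4 k hk'), add_zero]

/-- Induction on a finite set of planes outside which the defect vanishes. The Arf relation
guarantees that the process never stops at a single plane with both values equal to `1`. -/
theorem exists_defect_eq_zero (hε : ∀ a, ε (star a) = ε a) (h1 : (1 : A) ∈ Γ.toAddSubgroup)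
    (s : Finset ℕ) {α : Aut A (ℕ ⊕ ℕ)} (hα : α ∈ SU T Γ)
    (hs : ∀ i, i ∉ s → defect ε α (e i) = 0 ∧ defect ε α (f i) = 0) :
    ∃ ρ ∈ RU T Γ, ∀ i, defect ε (α * ρ) (e i) = 0 ∧ defect ε (α * ρ) (f i) = 0 := by
  induction s using Finset.strongInduction generalizing α with
  | H s ih =>
  -- Once a preliminary move produces a plane of `s` with vanishing product, that plane is cleared
  -- and removed from `s`.
  have step : ∀ ρ ∈ RU T Γ, (∀ k, k ∉ s → defect ε (α * ρ) (e k) = 0 ∧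
      defect ε (α * ρ) (f k) = 0) →
      ∀ i ∈ s, defect ε (α * ρ) (e i) * defect ε (α * ρ) (f i) = 0 →
      ∃ ρ ∈ RU T Γ, ∀ i, defect ε (α * ρ) (e i) = 0 ∧ defect ε (α * ρ) (f i) = 0 := by
    intro ρ hρ hs' i hi hi'
    have hαρ := mul_mem hα (RU_le_SU T Γ hρ)
    obtain ⟨σ, hσ, s1, s2, s3⟩ := exists_clear hε h1 hαρ hi'
    obtain ⟨θ, hθ, t⟩ := ih (s.erase i) (Finset.erase_ssubset hi)
      (mul_mem hαρ (RU_le_SU T Γ hσ)) fun k hk => by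
        by_cases hki : k = i
        · subst hki
          exact ⟨s1, s2⟩
        · rw [(s3 k hki).1, (s3 k hki).2]
          exact hs' k fun H => hk (Finset.mem_erase.2 ⟨hki, H⟩)
    refine ⟨ρ * σ * θ, mul_mem (mul_mem hρ hσ) hθ, ?_⟩
    simpa only [mul_assoc] using t
  by_cases hex : ∃ i ∈ s, defect ε α (e i) * defect ε α (f i) = 0
  · obtain ⟨i, hi, hi'⟩ := hex
    exact step 1 (one_mem _) (by simpa only [mul_one] using hs) i hi (by rwa [mul_one])
  push Not at hex
  have he : ∀ i ∈ s, defect ε α (e i) = 1 := fun i hi =>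
    (defect_eq_zero_or_one ε α (e i)).resolve_left (left_ne_zero_of_mul (hex i hi))
  have hf : ∀ i ∈ s, defect ε α (f i) = 1 := fun i hi =>
    (defect_eq_zero_or_one ε α (f i)).resolve_left (right_ne_zero_of_mul (hex i hi))
  rcases s.eq_empty_or_nonempty with rfl | ⟨i, hi⟩
  · exact ⟨1, one_mem _, fun i => by rw [mul_one]; exact hs i (Finset.notMem_empty i)⟩
  -- If `s` were `{i}`, the Arf relation would read `1 * 1 = 0`.
  obtain ⟨j, hj, hji⟩ : ∃ j ∈ s, j ≠ i := by
    by_contra! H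
    have h2 := sum_defect_finset_eq_zero hε hα s fun k hk => (hs k hk).1
    rw [Finset.eq_singleton_iff_unique_mem.2 ⟨hi, H⟩, Finset.sum_singleton] at h2
    exact hex i hi h2
  -- The merge may alter the defect at `f_i` and on plane `j`. This is harmless: plane `i` is
  -- cleared next, and plane `j` stays in the remaining set.
  obtain ⟨ρ, hρ, r1, r2⟩ := exists_merge hε hα hji.symm (he i hi) (he j hj)
  refine step ρ hρ (fun k hk => ?_) i hi (by rw [r1, zero_mul])
  obtain ⟨h2, h3⟩ := r2 k (fun H => hk (H ▸ hi)) (fun H => hk (H ▸ hj))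
  rw [h2, h3]
  exact hs k hk

/-- Every element of `SU(A, Γ')` becomes an element of `SU(A, Γ)` after multiplication with an
element of `RU(A, Γ')`, provided `Γ` contains the kernel of a star-invariant homomorphism
`Γ' → 𝔽₂` and `1 ∈ Γ'`. -/
theorem exists_mul_mem_SU (hε : ∀ a, ε (star a) = ε a) {Γ' : FormParameter A}
    (h1 : (1 : A) ∈ Γ'.toAddSubgroup)
    (hΓ : ∀ c ∈ Γ'.toAddSubgroup, ε c = 0 → c ∈ Γ.toAddSubgroup) {α : Aut A (ℕ ⊕ ℕ)}
    (hα : α ∈ SU T Γ') : ∃ ρ ∈ RU T Γ', α * ρ ∈ SU T Γ := by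
  obtain ⟨m, hm⟩ := exists_simpleOn block block_mono exists_mem_block hα.1
  have hfix : ∀ p, p ∉ block m → α (Finsupp.single p 1) = Finsupp.single p 1 := fun p hp =>
    (simpleOn_props hm).2 _ (Finsupp.single_mem_supported A 1 hp)
  obtain ⟨ρ, hρ, h⟩ := exists_defect_eq_zero hε h1 (Finset.range m) hα fun i hi =>
    ⟨defect_of_fixed ε (hfix (Sum.inl i) fun H => hi (Finset.mem_range.2 H)),
      defect_of_fixed ε (hfix (Sum.inr i) fun H => hi (Finset.mem_range.2 H))⟩
  exact ⟨ρ, hρ, mem_SU_of_defect hΓ (mul_mem hα (RU_le_SU T Γ' hρ)) (fun i => (h i).1)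
    fun i => (h i).2⟩

theorem L3.map_surjective {Γ' : FormParameter A} (hε : ∀ a, ε (star a) = ε a)
    (hle : Γ.toAddSubgroup ≤ Γ'.toAddSubgroup) (h1 : (1 : A) ∈ Γ'.toAddSubgroup)
    (hΓ : ∀ c ∈ Γ'.toAddSubgroup, ε c = 0 → c ∈ Γ.toAddSubgroup) :
    Function.Surjective (L3.map T hle) := by
  intro x
  obtain ⟨α, rfl⟩ := QuotientGroup.mk_surjective x
  obtain ⟨ρ, hρ, h⟩ := exists_mul_mem_SU hε h1 hΓ α.2
  refine ⟨QuotientGroup.mk ⟨α * ρ, h⟩, ?_⟩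
  refine (QuotientGroup.eq.2 ?_ : (QuotientGroup.mk (Subgroup.inclusion (SU_mono T hle) _) :
    SU T Γ' ⧸ (RU T Γ').subgroupOf (SU T Γ')) = QuotientGroup.mk α)
  rw [Subgroup.mem_subgroupOf]
  -- The classes of `α * ρ` and `α` agree because `(α * ρ)⁻¹ * α = ρ⁻¹`.
  change (α * ρ : Aut A (ℕ ⊕ ℕ))⁻¹ * α ∈ RU T Γ'
  simpa using hρ

end Moves

/-! ### The augmentation mod 2 of `ℤ[π]` -/

section GroupRing

variable (π : Type*) [Group π]

/-- The augmentation modulo 2 of the integral group ring. -/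
noncomputable def augTwo : MonoidAlgebra ℤ π →+* ZMod 2 :=
  (MonoidAlgebra.lift ℤ (ZMod 2) π 1 : MonoidAlgebra ℤ π →ₐ[ℤ] ZMod 2)

theorem augTwo_star (a : MonoidAlgebra ℤ π) : augTwo π (star a) = augTwo π a := by
  induction a using MonoidAlgebra.induction_linear with
  | zero => simp
  | add x y hx hy => rw [star_add, map_add, map_add, hx, hy]
  | single g n =>
    change augTwo π (MonoidAlgebra.mapDomain (·⁻¹) (MonoidAlgebra.single g n)) = _
    simp [augTwo]

theorem one_mem_tildeParameter :
    (1 : MonoidAlgebra ℤ π) ∈ (tildeParameter π).toAddSubgroup :=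
  ⟨1, 0, by simp⟩

/-- On `n + a + ā` the augmentation mod 2 is `n mod 2`, and an even `n = 2k` is itself `k + k̄`. -/
theorem mem_minParameter_of_augTwo (c : MonoidAlgebra ℤ π)
    (hc : c ∈ (tildeParameter π).toAddSubgroup) (h : augTwo π c = 0) :
    c ∈ (minParameter π).toAddSubgroup := by
  obtain ⟨n, a, rfl⟩ := hc
  rw [map_add, map_add, augTwo_star, CharTwo.add_self_eq_zero, add_zero, map_zsmul, map_one,
    zsmul_one] at h
  obtain ⟨k, rfl⟩ := (ZMod.intCast_zmod_eq_zero_iff_dvd n 2).1 h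
  refine ⟨k • 1 + a, ?_⟩
  rw [star_add, star_zsmul, star_one, mul_comm, Nat.cast_ofNat, mul_smul, two_smul, smul_add]
  abel

end GroupRing

end OddL

theorem lemma3p5 (π : Type*) [Group π] :
    Function.Surjective (OddL.natMap π : OddL.Ls3 π →* OddL.LsTilde3 π) :=
  OddL.L3.map_surjective (OddL.augTwo_star π) (OddL.minParameter_le π)
    (OddL.one_mem_tildeParameter π) (OddL.mem_minParameter_of_augTwo π)
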